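/- A \emph{conjunctive query} $Q$ is a non-empty finite conjunction of atoms $r(u_1,\dots,u_\rho)$, where $r$ is a relation symbol of arity $\rho$ and each $u_i$ is a variable or a constant. The hypergraph $\mathcal H_A$ of a finite collection $A$ of atoms has as nodes the variables occurring in $A$ and, for each atom of $A$, a hyperedge consisting of the variables of that atom; let $\mathcal H_Q$ be the hypergraph of the atoms of $Q$. For hypergraphs, $\mathcal H_1\le\mathcal H_2$ means that every hyperedge of $\mathcal H_1$ is contained in some hyperedge of $\mathcal H_2$. A finite hypergraph is \emph{acyclic} if it has a join tree, i.e. a tree whose vertices are its hyperedges such that any node occurring in two hyperedges occurs in every hyperedge on the path linking them. A \emph{tree projection} of $\mathcal H_1$ with respect to $\mathcal H_2$ is an acyclic hypergraph $\mathcal H_a$ with $\mathcal H_1\le\mathcal H_a\le\mathcal H_2$. A \emph{generalized hypertree decomposition} of a hypergraph $\mathcal H$ is a triple $\langle T,\chi,\lambda\rangle$, where $T$ is a finite rooted tree and each vertex $p$ of $T$ is labelled with a set $\chi(p)$ of nodes and a set $\lambda(p)$ of hyperedges of $\mathcal H$, such that: every hyperedge is contained in some $\chi(p)$; for every node $Y$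 the set $\{p : Y\in\chi(p)\}$ induces a connected subtree of $T$; and $\chi(p)\subseteq\bigcup\lambda(p)$ for every $p$. Its width is $\max_p|\lambda(p)|$. A parameterized problem is \emph{fixed-parameter tractable} if there are an algorithm, a computable function $f$ and a constant $d$ such that the algorithm solves every instance of size $n$ and parameter $k$ in time at most $f(k)\,n^{d}$. (Running times are those of a fixed program of a deterministic machine model polynomially equivalent to Turing machines, and instances are encoded in the usual way, with names in binary.) \textbf{Theorem.} The following problem is fixed-parameter tractable: given a conjunctive query $Q$ and a finite collection $\mathcal V$ of atoms (views), compute a tree projection of $\mathcal H_Q$ with respect to $\mathcal H_{\mathcal V}$, or report that there is none; the parameter is the maximum arity of the relations occurring in $(Q,\mathcal V)$. \textbf{Corollary.} For every fixed integer $w\ge 1$, the following problem is fixed-parameter tractable: given a conjunctive query $Q$, compute a generalized hypertree decomposition of $\mathcal H_Q$ of width at most $w$, or report that there is none; the parameter is the maximum arity of the atoms of $Q$. -/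

import Mathlib

namespace TreeProj

/-! ### Model of computation

Structured `while` programs over binary trees (the textbook `WHILE` language of Jones). There are
finitely many program variables, each holding a binary tree; a program has a fixed text and runs on
inputs of arbitrary size. Every operation is charged the full size of the trees that it produces
(nothing is shared for free), so running times agree, up to a polynomial, with those of multi-tape
Turing machines, in both directions, and outputs are never larger than the running time. -/

/-- The data values: binary trees without labels. -/
inductive BTree : Type
  | leaf : BTree
  | pair : BTree → BTree → BTree
  deriving DecidableEq

/-- The number of nodes of a tree. -/
def BTree.size : BTree → ℕ
  | .leaf => 1
  | .pair a b => a.size + b.size + 1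

/-- Left component; `leaf` for a leaf. -/
def BTree.hd : BTree → BTree
  | .leaf => .leaf
  | .pair a _ => a

/-- Right component; `leaf` for a leaf. -/
def BTree.tl : BTree → BTree
  | .leaf => .leaf
  | .pair _ b => b

/-- Contents of the program variables. -/
abbrev Store : Type := ℕ → BTree

/-- Expressions: program variables, constants, pairing, projections and an equality test. -/
inductive Expr : Type
  | var : ℕ → Expr
  | const : BTree → Expr
  | pair : Expr → Expr → Expr
  | hd : Expr → Expr
  | tl : Expr → Expr
  | isEq : Expr → Expr → Expr

/-- The value of an expression. Truth is `pair leaf leaf`, falsity is `leaf`. -/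
def Expr.eval (s : Store) : Expr → BTree
  | .var i => s i
  | .const t => t
  | .pair e₁ e₂ => .pair (e₁.eval s) (e₂.eval s)
  | .hd e => (e.eval s).hd
  | .tl e => (e.eval s).tl
  | .isEq e₁ e₂ => if e₁.eval s = e₂.eval s then .pair .leaf .leaf else .leaf

/-- The cost of evaluating an expression: every subexpression costs one plus the size of its
value. -/
def Expr.cost (s : Store) : Expr → ℕ
  | .var i => 1 + (s i).size
  | .const t => 1 + t.size
  | .pair e₁ e₂ => e₁.cost s + e₂.cost s + (1 + ((Expr.pair e₁ e₂).eval s).size)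
  | .hd e => e.cost s + (1 + ((Expr.hd e).eval s).size)
  | .tl e => e.cost s + (1 + ((Expr.tl e).eval s).size)
  | .isEq e₁ e₂ => e₁.cost s + e₂.cost s + (1 + ((Expr.isEq e₁ e₂).eval s).size)

/-- Programs. -/
inductive Prog : Type
  | skip : Prog
  | assign : ℕ → Expr → Prog
  | seq : Prog → Prog → Prog
  | ite : Expr → Prog → Prog → Prog
  | loop : Expr → Prog → Prog

/-- `Runs p s s' t`: started on the store `s`, the program `p` halts with the store `s'` after time
exactly `t`. In a conditional or a loop, every value but `leaf` counts as true; `loop e p` is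
"while `e` do `p`". -/
inductive Runs : Prog → Store → Store → ℕ → Prop
  | skip (s : Store) : Runs .skip s s 1
  | assign (i : ℕ) (e : Expr) (s : Store) :
      Runs (.assign i e) s (Function.update s i (e.eval s)) (e.cost s + 1)
  | seq {p q : Prog} {s₁ s₂ s₃ : Store} {t₁ t₂ : ℕ} :
      Runs p s₁ s₂ t₁ → Runs q s₂ s₃ t₂ → Runs (.seq p q) s₁ s₃ (t₁ + t₂ + 1)
  | iteTrue {e : Expr} {p q : Prog} {s s' : Store} {t : ℕ} :
      e.eval s ≠ .leaf → Runs p s s' t → Runs (.ite e p q) s s' (e.cost s + t + 1)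
  | iteFalse {e : Expr} {p q : Prog} {s s' : Store} {t : ℕ} :
      e.eval s = .leaf → Runs q s s' t → Runs (.ite e p q) s s' (e.cost s + t + 1)
  | loopStop {e : Expr} {p : Prog} {s : Store} :
      e.eval s = .leaf → Runs (.loop e p) s s (e.cost s + 1)
  | loopStep {e : Expr} {p : Prog} {s₁ s₂ s₃ : Store} {t₁ t₂ : ℕ} :
      e.eval s₁ ≠ .leaf → Runs p s₁ s₂ t₁ → Runs (.loop e p) s₂ s₃ t₂ →
      Runs (.loop e p) s₁ s₃ (e.cost s₁ + t₁ + t₂ + 1)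

/-- The input is placed in variable `0`; all other variables hold `leaf`. -/
def inputStore (x : BTree) : Store := fun i => if i = 0 then x else .leaf

/-- On input `x`, the program `p` halts within time `T` with output `y` (in variable `0`). -/
def OutputsWithin (p : Prog) (x y : BTree) (T : ℕ) : Prop :=
  ∃ (s : Store) (t : ℕ), Runs p (inputStore x) s t ∧ s 0 = y ∧ t ≤ T

/-! ### Encodings -/

/-- A list is encoded as a right comb. -/
def encList {α : Type} (enc : α → BTree) : List α → BTree
  | [] => .leaf
  | a :: l => .pair (enc a) (encList enc l)

def encBool : Bool → BTree
  | false => .leaf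
  | true => .pair .leaf .leaf

/-- Natural numbers are encoded in binary, least significant bit first. -/
def encNat (n : ℕ) : BTree := encList encBool n.bits

/-! ### Parameterized search problems -/

/-- A parameterized search problem. Instances have one encoding each; a solution may have several
encodings (for instance, a set may be listed in any order). -/
structure ParamProblem where
  Instance : Type
  Solution : Type
  param : Instance → ℕ
  IsSolution : Instance → Solution → Prop
  encInstance : Instance → BTree
  EncodesSolution : BTree → Solution → Prop

/-- The output `y` is a correct answer on the instance `x`: either it reports a solution, or it is
the answer "no" (`leaf`) and there is no solution. -/
def ParamProblem.CorrectAnswer (P : ParamProblem) (x : P.Instance) (y : BTree) : Prop :=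
  (∃ (z : P.Solution) (t : BTree),
      y = .pair .leaf t ∧ P.EncodesSolution t z ∧ P.IsSolution x z) ∨
    (y = .leaf ∧ ¬ ∃ z : P.Solution, P.IsSolution x z)

/-- Fixed-parameter tractability: one algorithm solves all instances in time `f k * n ^ d`, where
`k` is the parameter and `n` the size of the instance, `f` is computable and `d` is a constant. -/
def ParamProblem.FixedParameterTractable (P : ParamProblem) : Prop :=
  ∃ (p : Prog) (f : ℕ → ℕ) (d : ℕ), Computable f ∧
    ∀ x : P.Instance, ∃ y : BTree,
      P.CorrectAnswer x y ∧
      OutputsWithin p (P.encInstance x) y (f (P.param x) * (P.encInstance x).size ^ d)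

/-! ### Hypergraphs, acyclicity and tree projections -/

/-- Each hyperedge of `H₁` is contained in at least one hyperedge of `H₂`. -/
def Covered (H₁ H₂ : Hypergraph ℕ) : Prop :=
  ∀ h₁ ∈ H₁.edgeSet, ∃ h₂ ∈ H₂.edgeSet, h₁ ⊆ h₂

/-- A join tree: a tree on the hyperedges such that a node that occurs in two hyperedges occurs in
every hyperedge on the path linking them. -/
def IsJoinTree (H : Hypergraph ℕ) (T : SimpleGraph H.edgeSet) : Prop :=
  T.IsTree ∧
    ∀ (h₁ h₂ : H.edgeSet) (p : T.Walk h₁ h₂), p.IsPath →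
      ∀ X : ℕ, X ∈ h₁.1 → X ∈ h₂.1 → ∀ h ∈ p.support, X ∈ h.1

/-- (Alpha-)acyclicity. -/
def IsAcyclicHypergraph (H : Hypergraph ℕ) : Prop :=
  ∃ T : SimpleGraph H.edgeSet, IsJoinTree H T

/-- `H` is a tree projection of `H₁` with respect to `H₂`. -/
def IsTreeProjection (H₁ H₂ H : Hypergraph ℕ) : Prop :=
  H.vertexSet.Finite ∧ IsAcyclicHypergraph H ∧ Covered H₁ H ∧ Covered H H₂

/-! ### Conjunctive queries and views -/

/-- A term is a variable or a constant. -/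
inductive Term : Type
  | var : ℕ → Term
  | const : ℕ → Term

/-- An atom `r(u₁, …, u_ρ)`. -/
structure Atom where
  rel : ℕ
  terms : List Term

/-- The arity of the relation of an atom. -/
def Atom.arity (a : Atom) : ℕ := a.terms.length

/-- The set of variables of an atom. -/
def Atom.vars (a : Atom) : Set ℕ := {X | Term.var X ∈ a.terms}

/-- A conjunctive query: a non-empty finite conjunction of atoms. -/
structure ConjQuery where
  atoms : List Atom
  nonempty : atoms ≠ []

/-- The hypergraph of a finite collection of atoms: the nodes are the variables that occur in it,
and there is one hyperedge for the set of variables of each atom. -/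
def hypergraphOf (A : List Atom) : Hypergraph ℕ where
  vertexSet := {X | ∃ a ∈ A, X ∈ a.vars}
  edgeSet := {h | ∃ a ∈ A, h = a.vars}
  subset_vertexSet_of_mem_edgeSet' := by
    rintro h ⟨a, ha, rfl⟩ X hX
    exact ⟨a, ha, hX⟩

/-- The maximum arity of a collection of atoms. -/
def maxArity (A : List Atom) : ℕ := (A.map Atom.arity).foldr max 0

def encTerm : Term → BTree
  | .var X => .pair (encBool false) (encNat X)
  | .const c => .pair (encBool true) (encNat c)

def encAtom (a : Atom) : BTree := .pair (encNat a.rel) (encList encTerm a.terms)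

def encAtoms (A : List Atom) : BTree := encList encAtom A

/-! ### Computing tree projections -/

/-- `t` encodes the finite hypergraph `H` as the list of its nodes and the list of its hyperedges,
each a list of nodes. -/
def EncodesHypergraph (t : BTree) (H : Hypergraph ℕ) : Prop :=
  ∃ (ns : List ℕ) (es : List (List ℕ)),
    H.vertexSet = {X | X ∈ ns} ∧ H.edgeSet = {h | ∃ e ∈ es, h = {X | X ∈ e}} ∧
    t = .pair (encList encNat ns) (encList (encList encNat) es)

/-- Given a conjunctive query `Q` and a collection `V` of views, compute a tree projection of the
hypergraph of `Q` with respect to the hypergraph of `V`, or report that there is none. The parameter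
is the maximum arity of the relations that occur in `Q` and `V`. -/
def treeProjectionProblem : ParamProblem where
  Instance := ConjQuery × List Atom
  Solution := Hypergraph ℕ
  param x := maxArity (x.1.atoms ++ x.2)
  IsSolution x H := IsTreeProjection (hypergraphOf x.1.atoms) (hypergraphOf x.2) H
  encInstance x := .pair (encAtoms x.1.atoms) (encAtoms x.2)
  EncodesSolution := EncodesHypergraph

/-! ### Computing generalized hypertree decompositions -/

/-- A labelled rooted graph `⟨T, χ, lam⟩` on the vertices `0, …, N - 1`. -/
structure Hypertree where
  N : ℕ
  T : SimpleGraph (Fin N)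
  root : Fin N
  χ : Fin N → Set ℕ
  lam : Fin N → Set (Set ℕ)

/-- `D` is a generalized hypertree decomposition of `H`. -/
structure IsGHD (H : Hypergraph ℕ) (D : Hypertree) : Prop where
  isTree : D.T.IsTree
  χ_subset : ∀ p, D.χ p ⊆ H.vertexSet
  lam_subset : ∀ p, D.lam p ⊆ H.edgeSet
  edge_covered : ∀ h ∈ H.edgeSet, ∃ p, h ⊆ D.χ p
  connected : ∀ Y ∈ H.vertexSet, (D.T.induce {p | Y ∈ D.χ p}).Preconnected
  χ_subset_lam : ∀ p, D.χ p ⊆ ⋃₀ D.lam p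

/-- The width of `D`, the maximum of `|lam p|`, is at most `w`. -/
def Hypertree.WidthAtMost (D : Hypertree) (w : ℕ) : Prop := ∀ p, (D.lam p).encard ≤ w

/-- The encoding of a hypertree: its root, the list of its vertex labels, in the order of the
vertices, and a list of its (tree) edges. -/
def EncodesHypertree (t : BTree) (D : Hypertree) : Prop :=
  ∃ (labels : Fin D.N → List ℕ × List (List ℕ)) (arcs : List (Fin D.N × Fin D.N)),
    (∀ p, D.χ p = {X | X ∈ (labels p).1}) ∧
    (∀ p, D.lam p = {h | ∃ e ∈ (labels p).2, h = {X | X ∈ e}}) ∧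
    D.T = SimpleGraph.fromRel (fun p q => (p, q) ∈ arcs) ∧
    t = .pair (encNat D.root.1)
      (.pair
        (encList (fun l => .pair (encList encNat l.1) (encList (encList encNat) l.2))
          (List.ofFn labels))
        (encList (fun a => .pair (encNat a.1.1) (encNat a.2.1)) arcs))

/-- Given a conjunctive query `Q`, compute a generalized hypertree decomposition of its hypergraph
of width at most `w`, or report that there is none. The parameter is the maximum arity of the
atoms of `Q`. -/
def ghdProblem (w : ℕ) : ParamProblem where
  Instance := ConjQuery
  Solution := Hypertree
  param Q := maxArity Q.atoms
  IsSolution Q D := IsGHD (hypergraphOf Q.atoms) D ∧ D.WidthAtMost w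
  encInstance Q := encAtoms Q.atoms
  EncodesSolution := EncodesHypertree

end TreeProj

/-!
Call a set of nodes an admissible bag if it is contained in a view; when a decomposition of width
`w` is sought, the unions of at most `w` hyperedges act as views. A tree projection is essentially a
tree decomposition with admissible bags, and if the arities are at most `k`, then a view has at most
`2 ^ k` subsets (a union of `w` hyperedges has at most `2 ^ (w * k)`), so the time bound allows
listing all admissible bags.

Call a component of the complement of an admissible bag decomposable if some admissible bag contains
the boundary of the component, meets the component, and splits it into decomposable components.
Since the components shrink, this recursive notion is also a greatest fixed point, which is reached
by deleting bad components in rounds. A decomposition is grown greedily: as long as a vertex is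
missing, its component in the complement of the covered vertices receives a bag as above. What this
bag shares with the earlier ones belongs to the boundary of the component, which lies in a single
earlier bag; this is the running intersection property, and it yields a join tree. Conversely, order
the bags of a tree decomposition with admissible bags from the root to the leaves. A component whose
boundary occurs earlier than the component itself is never deleted, because the first bag that meets
it, cut down to the component and its boundary, splits it into components of the same kind.

For the running time, functions computable in polynomial time are closed under composition, pairing,
case distinction and folds over lists with polynomially bounded accumulators.
-/

namespace TreeProj

open Polynomial

/-! ### Polynomial bounds -/

theorem monotone_eval (P : ℕ[X]) : Monotone fun n => P.eval n := fun m n h => by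
  simp only [eval_eq_sum_range]
  gcongr

theorem eval_le_eval_one_mul_pow (P : ℕ[X]) {n : ℕ} (hn : 1 ≤ n) :
    P.eval n ≤ P.eval 1 * n ^ P.natDegree := by
  simp only [eval_eq_sum_range, one_pow, mul_one, Finset.sum_mul]
  gcongr with i hi
  exact Nat.lt_succ_iff.1 (Finset.mem_range.1 hi)

/-! ### Encodings -/

/-- Types whose elements are encoded as binary trees. Nothing is assumed about the encoding; it is
injective on the types in which membership is tested. -/
class TreeEncodable (α : Type) where
  enc : α → BTree

open TreeEncodable (enc)

instance : TreeEncodable ℕ := ⟨encNat⟩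
instance : TreeEncodable Bool := ⟨encBool⟩
instance {α : Type} [TreeEncodable α] : TreeEncodable (List α) := ⟨encList enc⟩
instance {α β : Type} [TreeEncodable α] [TreeEncodable β] : TreeEncodable (α × β) :=
  ⟨fun x => .pair (enc x.1) (enc x.2)⟩
instance {α : Type} [TreeEncodable α] : TreeEncodable (Option α) :=
  ⟨fun o => o.elim .leaf fun a => .pair .leaf (enc a)⟩
instance {α : Type} [TreeEncodable α] {p : α → Prop} : TreeEncodable {a // p a} :=
  ⟨fun a => enc a.1⟩
instance : TreeEncodable Term := ⟨encTerm⟩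
instance : TreeEncodable Atom := ⟨encAtom⟩
instance : TreeEncodable ConjQuery := ⟨fun Q => encAtoms Q.atoms⟩

/-- The size of the encoding of `a`, in which running times are measured. -/
def encSize {α : Type} [TreeEncodable α] (a : α) : ℕ := (enc a).size

section

variable {α β γ δ : Type} [TreeEncodable α] [TreeEncodable β] [TreeEncodable γ] [TreeEncodable δ]

theorem encSize_pos (a : α) : 1 ≤ encSize a := by
  unfold encSize
  cases enc a <;> simp [BTree.size]

@[simp] theorem size_enc (a : α) : (enc a).size = encSize a := rfl

@[simp] theorem encSize_pair (a : α) (b : β) : encSize (a, b) = encSize a + encSize b + 1 := rfl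

@[simp] theorem encSize_nil : encSize ([] : List α) = 1 := rfl

@[simp] theorem encSize_cons (a : α) (l : List α) :
    encSize (a :: l) = encSize a + encSize l + 1 := rfl

theorem encSize_bool_le (a : Bool) : encSize a ≤ 3 := by
  cases a <;> simp [encSize, enc, encBool, BTree.size]

theorem encSize_append (l l' : List α) : encSize (l ++ l') + 1 = encSize l + encSize l' := by
  induction l with
  | nil => simp [add_comm]
  | cons a l ih => simp only [List.cons_append, encSize_cons]; omega

theorem length_lt_encSize (l : List α) : l.length < encSize l := by
  induction l with
  | nil => simp
  | cons a l ih => simp only [List.length_cons, encSize_cons]; omega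

theorem encSize_le_of_sublist {l l' : List α} (h : l.Sublist l') : encSize l ≤ encSize l' := by
  induction h with
  | slnil => exact le_rfl
  | cons a _ ih => simp only [encSize_cons]; omega
  | cons_cons a _ ih => simp only [encSize_cons]; omega

theorem encSize_lt_of_mem {a : α} {l : List α} (h : a ∈ l) : encSize a < encSize l := by
  have hsub := encSize_le_of_sublist (List.singleton_sublist.2 h)
  simp only [encSize_cons] at hsub
  omega

theorem encSize_list_le {l : List α} {M : ℕ} (h : ∀ a ∈ l, encSize a ≤ M) :
    encSize l ≤ l.length * (M + 1) + 1 := by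
  induction l with
  | nil => simp
  | cons a l ih =>
    obtain ⟨ha, hl⟩ := List.forall_mem_cons.1 h
    have hl' := ih hl
    simp only [encSize_cons, List.length_cons, add_mul]
    omega

/-! ### Expressions and programs on one variable -/

/-- If variable `b` holds `x`, then the expression `e` has the value `y` and costs at most `T`. -/
def EvalsAt (e : Expr) (b : ℕ) (x y : BTree) (T : ℕ) : Prop :=
  ∀ s : Store, s b = x → e.eval s = y ∧ e.cost s ≤ T

namespace EvalsAt

variable {e e' : Expr} {b T T' : ℕ} {x y y' : BTree}

theorem mono (h : EvalsAt e b x y T) (hT : T ≤ T') : EvalsAt e b x y T' := fun s hs =>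
  ⟨(h s hs).1, (h s hs).2.trans hT⟩

theorem var : EvalsAt (.var b) b x x (1 + x.size) := fun s hs => by
  simp [Expr.eval, Expr.cost, hs]

theorem const : EvalsAt (.const y) b x y (1 + y.size) := fun _ _ => ⟨rfl, le_rfl⟩

theorem pair (h : EvalsAt e b x y T) (h' : EvalsAt e' b x y' T') :
    EvalsAt (.pair e e') b x (.pair y y') (T + T' + (1 + (BTree.pair y y').size)) := fun s hs => by
  obtain ⟨hv, hc⟩ := h s hs
  obtain ⟨hv', hc'⟩ := h' s hs
  simp only [Expr.eval, Expr.cost, hv, hv', true_and]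
  omega

theorem hd (h : EvalsAt e b x y T) : EvalsAt (.hd e) b x y.hd (T + (1 + y.hd.size)) :=
  fun s hs => by
  obtain ⟨hv, hc⟩ := h s hs
  simp only [Expr.eval, Expr.cost, hv, true_and]
  omega

theorem tl (h : EvalsAt e b x y T) : EvalsAt (.tl e) b x y.tl (T + (1 + y.tl.size)) :=
  fun s hs => by
  obtain ⟨hv, hc⟩ := h s hs
  simp only [Expr.eval, Expr.cost, hv, true_and]
  omega

theorem isEq (h : EvalsAt e b x y T) (h' : EvalsAt e' b x y' T') :
    EvalsAt (.isEq e e') b x (encBool (decide (y = y'))) (T + T' + 4) := fun s hs => by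
  obtain ⟨hv, hc⟩ := h s hs
  obtain ⟨hv', hc'⟩ := h' s hs
  by_cases hy : y = y' <;>
    simp only [Expr.eval, Expr.cost, hv, hv', hy, encBool, BTree.size, decide_true, decide_false,
      if_true, if_false, true_and] <;> omega

end EvalsAt

/-- If variable `b` holds `x`, then the program `p` halts within time `T`, leaves `y` in variable
`b` and does not change the variables below `b`. The variables from `b + 1` on are scratch space
with arbitrary contents. -/
def RunsAt (p : Prog) (b : ℕ) (x y : BTree) (T : ℕ) : Prop :=
  ∀ s : Store, s b = x → ∃ s' t, Runs p s s' t ∧ s' b = y ∧ (∀ i < b, s' i = s i) ∧ t ≤ T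

namespace RunsAt

variable {p q : Prog} {e : Expr} {b T T₁ T₂ T₃ : ℕ} {x y z v : BTree}

theorem mono (h : RunsAt p b x y T₁) (hT : T₁ ≤ T₂) : RunsAt p b x y T₂ := fun s hs =>
  let ⟨s', t, hrun, hval, hframe, ht⟩ := h s hs
  ⟨s', t, hrun, hval, hframe, ht.trans hT⟩

theorem assign (he : EvalsAt e b x y T) : RunsAt (.assign b e) b x y (T + 1) := fun s hs => by
  obtain ⟨hv, hc⟩ := he s hs
  refine ⟨_, _, .assign b e s, by simp [hv], fun i hi => ?_, by omega⟩
  rw [Function.update_of_ne hi.ne]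

theorem seq (hp : RunsAt p b x y T₁) (hq : RunsAt q b y z T₂) :
    RunsAt (.seq p q) b x z (T₁ + T₂ + 1) := fun s hs => by
  obtain ⟨s₁, t₁, hrun₁, hval₁, hframe₁, ht₁⟩ := hp s hs
  obtain ⟨s₂, t₂, hrun₂, hval₂, hframe₂, ht₂⟩ := hq s₁ hval₁
  exact ⟨s₂, _, hrun₁.seq hrun₂, hval₂, fun i hi => (hframe₂ i hi).trans (hframe₁ i hi), by omega⟩

theorem ite_true (he : EvalsAt e b x v T₁) (hv : v ≠ .leaf) (hp : RunsAt p b x y T₂) :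
    RunsAt (.ite e p q) b x y (T₁ + T₂ + 1) := fun s hs => by
  obtain ⟨rfl, hc⟩ := he s hs
  obtain ⟨s', t, hrun, hval, hframe, ht⟩ := hp s hs
  exact ⟨s', _, .iteTrue hv hrun, hval, hframe, by omega⟩

theorem ite_false (he : EvalsAt e b x .leaf T₁) (hq : RunsAt q b x y T₂) :
    RunsAt (.ite e p q) b x y (T₁ + T₂ + 1) := fun s hs => by
  obtain ⟨hv, hc⟩ := he s hs
  obtain ⟨s', t, hrun, hval, hframe, ht⟩ := hq s hs
  exact ⟨s', _, .iteFalse hv hrun, hval, hframe, by omega⟩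

theorem loop_stop (he : EvalsAt e b x .leaf T) : RunsAt (.loop e p) b x x (T + 1) := fun s hs => by
  obtain ⟨hv, hc⟩ := he s hs
  exact ⟨s, _, .loopStop hv, hs, fun _ _ => rfl, by omega⟩

theorem loop_step (he : EvalsAt e b x v T₁) (hv : v ≠ .leaf) (hp : RunsAt p b x y T₂)
    (hloop : RunsAt (.loop e p) b y z T₃) : RunsAt (.loop e p) b x z (T₁ + T₂ + T₃ + 1) :=
  fun s hs => by
  obtain ⟨rfl, hc⟩ := he s hs
  obtain ⟨s₁, t₁, hrun₁, hval₁, hframe₁, ht₁⟩ := hp s hs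
  obtain ⟨s₂, t₂, hrun₂, hval₂, hframe₂, ht₂⟩ := hloop s₁ hval₁
  exact ⟨s₂, _, .loopStep hv hrun₁ hrun₂, hval₂, fun i hi => (hframe₂ i hi).trans (hframe₁ i hi),
    by omega⟩

/-- Running `p` on a copy of the input keeps the input. No other rule uses a second variable. -/
theorem graph (hp : RunsAt p (b + 1) x y T) :
    RunsAt (.seq (.assign (b + 1) (.var b)) (.seq p (.assign b (.pair (.var b) (.var (b + 1))))))
      b x (.pair x y) (T + 3 * x.size + 2 * y.size + 10) := fun s hs => by
  obtain ⟨s', t, hrun, hval, hframe, ht⟩ :=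
    hp (Function.update s (b + 1) (s b)) (by rw [Function.update_self, hs])
  have hs' : s' b = x := by rw [hframe b (by omega), Function.update_of_ne (by omega), hs]
  refine ⟨_, _, .seq (.assign ..) (.seq hrun (.assign ..)), ?_, fun i hi => ?_, ?_⟩
  · rw [Function.update_self]
    simp only [Expr.eval, hs', hval]
  · rw [Function.update_of_ne hi.ne, hframe i (by omega), Function.update_of_ne (by omega)]
  · simp only [Expr.cost, Expr.eval, BTree.size, hs, hs', hval]
    omega

end RunsAt

/-! ### Functions computable in polynomial time -/

/-- `f` is computable in time polynomial in the measure `m` of its argument. -/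
def PolyTimeIn (m : α → ℕ) (f : α → β) : Prop :=
  ∃ P : ℕ[X], (∀ a, encSize (f a) ≤ P.eval (m a)) ∧
    ∀ b, ∃ p, ∀ a, RunsAt p b (enc a) (enc (f a)) (P.eval (m a))

/-- `f` is computable in time polynomial in the size of its argument. -/
def PolyTime (f : α → β) : Prop := PolyTimeIn encSize f

theorem Expr.size_eval_le_cost (s : Store) (e : Expr) : (e.eval s).size ≤ e.cost s := by
  cases e <;> simp only [Expr.eval, Expr.cost] <;> omega

theorem PolyTime.of_expr {f : α → β} (e : ℕ → Expr) (P : ℕ[X])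
    (he : ∀ b a, EvalsAt (e b) b (enc a) (enc (f a)) (P.eval (encSize a))) : PolyTime f := by
  refine ⟨P + 1, fun a => ?_, fun b => ⟨.assign b (e b), fun a => ?_⟩⟩
  · obtain ⟨hv, hc⟩ := he 0 a (fun _ => enc a) rfl
    have hsize := Expr.size_eval_le_cost (fun _ => enc a) (e 0)
    rw [hv, size_enc] at hsize
    simp only [eval_add, eval_one]
    omega
  · simpa only [eval_add, eval_one] using RunsAt.assign (he b a)

theorem PolyTimeIn.comp {m : α → ℕ} {m' : β → ℕ} {f : α → β} {g : β → γ} (hg : PolyTimeIn m' g)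
    (hf : PolyTimeIn m f) (Q : ℕ[X]) (hQ : ∀ a, m' (f a) ≤ Q.eval (m a)) :
    PolyTimeIn m fun a => g (f a) := by
  obtain ⟨P, -, hrun⟩ := hf
  obtain ⟨P', hsize', hrun'⟩ := hg
  have hle (a : α) : P'.eval (m' (f a)) ≤ P'.eval (Q.eval (m a)) := monotone_eval P' (hQ a)
  refine ⟨P + P'.comp Q + 1, fun a => ?_, fun b => ?_⟩
  · have hga := (hsize' (f a)).trans (hle a)
    simp only [eval_add, eval_comp, eval_one]
    omega
  · obtain ⟨p, hp⟩ := hrun b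
    obtain ⟨p', hp'⟩ := hrun' b
    refine ⟨.seq p p', fun a => ((hp a).seq ((hp' (f a)).mono (hle a))).mono ?_⟩
    simp only [eval_add, eval_comp, eval_one, le_rfl]

theorem PolyTime.comp {m : α → ℕ} {f : α → β} {g : β → γ} (hg : PolyTime g)
    (hf : PolyTimeIn m f) : PolyTimeIn m fun a => g (f a) :=
  let ⟨P, hsize, _⟩ := hf
  PolyTimeIn.comp hg hf P hsize

theorem PolyTime.exists_encSize_le {f : α → β} (hf : PolyTime f) :
    ∃ P : ℕ[X], ∀ a, encSize (f a) ≤ P.eval (encSize a) :=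
  let ⟨P, hsize, _⟩ := hf
  ⟨P, hsize⟩

theorem PolyTime.polyTimeIn {m : α → ℕ} {f : α → β} (hf : PolyTime f) (hm : ∀ a, encSize a ≤ m a) :
    PolyTimeIn m f := by
  obtain ⟨P, hsize, hrun⟩ := hf
  have hle (a : α) : P.eval (encSize a) ≤ P.eval (m a) := monotone_eval P (hm a)
  refine ⟨P, fun a => (hsize a).trans (hle a), fun b => ?_⟩
  obtain ⟨p, hp⟩ := hrun b
  exact ⟨p, fun a => (hp a).mono (hle a)⟩

namespace PolyTime

theorem id : PolyTime fun a : α => a :=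
  .of_expr (fun b => .var b) (X + 1) fun b a => EvalsAt.var.mono (by simp [add_comm])

theorem congr_enc {f : α → β} {g : α → γ} (hf : PolyTime f) (h : ∀ a, enc (f a) = enc (g a)) :
    PolyTime g := by
  have hsize (a : α) : encSize (f a) = encSize (g a) := congrArg BTree.size (h a)
  simpa only [PolyTime, PolyTimeIn, hsize, h] using hf

theorem congr {f g : α → β} (hf : PolyTime f) (h : ∀ a, f a = g a) : PolyTime g :=
  congr_enc hf fun a => congrArg enc (h a)

theorem of_enc_eq {f : α → β} (h : ∀ a, enc (f a) = enc a) : PolyTime f :=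
  congr_enc id fun a => (h a).symm

theorem const (y : β) : PolyTime fun _ : α => y :=
  .of_expr (fun _ => .const (enc y)) (C (1 + encSize y)) fun _ _ =>
    EvalsAt.const.mono (by simp)

theorem fst {f : α → β × γ} (hf : PolyTime f) : PolyTime fun a => (f a).1 :=
  comp (g := Prod.fst) (.of_expr (fun b => .hd (.var b)) (2 * X + 2) fun b a =>
    EvalsAt.var.hd.mono (by
      change 1 + encSize a + (1 + encSize a.1) ≤ _
      simp only [eval_add, eval_mul, eval_X, eval_ofNat]
      obtain ⟨a₁, a₂⟩ := a
      simp only [encSize_pair]; omega)) hf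

theorem snd {f : α → β × γ} (hf : PolyTime f) : PolyTime fun a => (f a).2 :=
  comp (g := Prod.snd) (.of_expr (fun b => .tl (.var b)) (2 * X + 2) fun b a =>
    EvalsAt.var.tl.mono (by
      change 1 + encSize a + (1 + encSize a.2) ≤ _
      simp only [eval_add, eval_mul, eval_X, eval_ofNat]
      obtain ⟨a₁, a₂⟩ := a
      simp only [encSize_pair]; omega)) hf

theorem some {f : α → β} (hf : PolyTime f) : PolyTime fun a => Option.some (f a) :=
  comp (g := Option.some) (.of_expr (fun b => .pair (.const .leaf) (.var b)) (2 * X + 6) fun b a =>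
    (EvalsAt.const.pair .var).mono (by
      simp only [eval_add, eval_mul, eval_X, eval_ofNat, BTree.size, size_enc]; omega)) hf

end PolyTime

/-! ### Pairing and case distinction -/

theorem PolyTimeIn.graph {m : α → ℕ} (hm : ∀ a, encSize a ≤ m a) {f : α → β}
    (hf : PolyTimeIn m f) : PolyTimeIn m fun a => (a, f a) := by
  obtain ⟨P, hsize, hrun⟩ := hf
  refine ⟨3 * P + 3 * X + 10, fun a => ?_, fun b => ?_⟩
  · have ha := hm a
    have hfa := hsize a
    simp only [encSize_pair, eval_add, eval_mul, eval_X, eval_ofNat]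
    omega
  · obtain ⟨p, hp⟩ := hrun (b + 1)
    refine ⟨_, fun a => (hp a).graph.mono ?_⟩
    have ha := hm a
    have hfa := hsize a
    simp only [size_enc, eval_add, eval_mul, eval_X, eval_ofNat]
    omega

theorem PolyTimeIn.pair {m : α → ℕ} (hm : ∀ a, encSize a ≤ m a) {f : α → β} {g : α → γ}
    (hf : PolyTimeIn m f) (hg : PolyTimeIn m g) : PolyTimeIn m fun a => (f a, g a) := by
  obtain ⟨P, hsize, _⟩ := id hf
  let m' : α × β → ℕ := fun x => m x.1 + encSize x
  have hm' (x : α × β) : encSize x ≤ m' x := Nat.le_add_left ..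
  have hgfst : PolyTimeIn m' fun x : α × β => g x.1 :=
    hg.comp ((PolyTime.id.fst).polyTimeIn hm') X fun x => by simp [m']
  have hgraph : PolyTimeIn m fun a => ((a, f a), g a) := by
    refine (hgfst.graph hm').comp (hf.graph hm) (2 * X + P + 1) fun a => ?_
    have ha := hm a
    have hfa := hsize a
    simp only [m', encSize_pair, eval_add, eval_mul, eval_X, eval_ofNat, eval_one]
    omega
  have hforget : PolyTime fun x : (α × β) × γ => (x.1.2, x.2) :=
    .of_expr (fun b => .pair (.tl (.hd (.var b))) (.tl (.var b))) (6 * X + 6) fun b x =>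
      (EvalsAt.var.hd.tl.pair EvalsAt.var.tl).mono (by
        obtain ⟨⟨a, y⟩, z⟩ := x
        simp only [enc, BTree.hd, BTree.tl, BTree.size, size_enc, encSize_pair, eval_add, eval_mul,
          eval_X, eval_ofNat]
        omega)
  exact hforget.comp hgraph

namespace PolyTime

theorem pair {f : α → β} {g : α → γ} (hf : PolyTime f) (hg : PolyTime g) :
    PolyTime fun a => (f a, g a) := PolyTimeIn.pair (fun _ => le_rfl) hf hg

theorem comp₂ {h : β → γ → δ} (hh : PolyTime fun x : β × γ => h x.1 x.2) {f : α → β} {g : α → γ}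
    (hf : PolyTime f) (hg : PolyTime g) : PolyTime fun a => h (f a) (g a) :=
  hh.comp (hf.pair hg)

theorem cons {f : α → β} {g : α → List β} (hf : PolyTime f) (hg : PolyTime g) :
    PolyTime fun a => f a :: g a :=
  comp₂ (h := fun b l => b :: l) (of_enc_eq fun _ => rfl) hf hg

theorem decide_eq [DecidableEq β] (hβ : Function.Injective (enc : β → BTree)) {f g : α → β}
    (hf : PolyTime f) (hg : PolyTime g) : PolyTime fun a => decide (f a = g a) := by
  refine comp₂ (h := fun x y => decide (x = y)) ?_ hf hg
  refine .of_expr (fun b => .isEq (.hd (.var b)) (.tl (.var b))) (4 * X + 8) fun b x => ?_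
  have henc : enc (decide (x.1 = x.2)) = encBool (decide (enc x.1 = enc x.2)) := by
    simp only [hβ.eq_iff]; rfl
  rw [henc]
  refine (EvalsAt.var.hd.isEq EvalsAt.var.tl).mono ?_
  change 1 + encSize x + (1 + encSize x.1) + (1 + encSize x + (1 + encSize x.2)) + 4 ≤ _
  obtain ⟨y, z⟩ := x
  simp only [encSize_pair, eval_add, eval_mul, eval_X, eval_ofNat]
  omega

theorem of_branches {f : α → β} (e : ℕ → Expr) (v : α → BTree) (P : ℕ[X])
    (he : ∀ b a, EvalsAt (e b) b (enc a) (v a) (P.eval (encSize a)))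
    (htrue : PolyTime fun a : {a // v a ≠ .leaf} => f a)
    (hfalse : PolyTime fun a : {a // v a = .leaf} => f a) : PolyTime f := by
  obtain ⟨P₁, hsize₁, hrun₁⟩ := htrue
  obtain ⟨P₂, hsize₂, hrun₂⟩ := hfalse
  refine ⟨P + P₁ + P₂ + 1, fun a => ?_, fun b => ?_⟩
  · simp only [eval_add, eval_one]
    by_cases ha : v a = .leaf
    · have hfa : encSize (f a) ≤ P₂.eval (encSize a) := hsize₂ ⟨a, ha⟩
      omega
    · have hfa : encSize (f a) ≤ P₁.eval (encSize a) := hsize₁ ⟨a, ha⟩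
      omega
  · obtain ⟨p, hp⟩ := hrun₁ b
    obtain ⟨q, hq⟩ := hrun₂ b
    refine ⟨.ite (e b) p q, fun a => ?_⟩
    simp only [eval_add, eval_one]
    by_cases ha : v a = .leaf
    · have hqa : RunsAt q b (enc a) (enc (f a)) (P₂.eval (encSize a)) := hq ⟨a, ha⟩
      exact (RunsAt.ite_false (ha ▸ he b a) hqa).mono (by omega)
    · have hpa : RunsAt p b (enc a) (enc (f a)) (P₁.eval (encSize a)) := hp ⟨a, ha⟩
      exact (RunsAt.ite_true (he b a) ha hpa).mono (by omega)

theorem coe {p : α → Prop} : PolyTime fun a : {a // p a} => (a : α) := of_enc_eq fun _ => rfl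

theorem ite {c : α → Bool} {f g : α → β} (hc : PolyTime c) (hf : PolyTime f) (hg : PolyTime g) :
    PolyTime fun a => if c a then f a else g a := by
  refine comp₂ (h := fun c a => if c then f a else g a) ?_ hc id
  refine of_branches (fun b => .hd (.var b)) (fun x => enc x.1) (2 * X + 2)
    (fun b x => EvalsAt.var.hd.mono ?_) ?_ ?_
  · change 1 + encSize x + (1 + encSize x.1) ≤ _
    obtain ⟨c, a⟩ := x
    simp only [encSize_pair, eval_add, eval_mul, eval_X, eval_ofNat]
    omega
  · refine congr (hf.comp (snd coe)) fun ⟨⟨c, a⟩, hx⟩ => ?_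
    cases c with
    | false => exact absurd rfl hx
    | true => rfl
  · refine congr (hg.comp (snd coe)) fun ⟨⟨c, a⟩, hx⟩ => ?_
    cases c with
    | false => rfl
    | true => cases hx

theorem list_cases {l : α → List β} {f : α → γ} {g : α → β → List β → γ} (hl : PolyTime l)
    (hf : PolyTime f) (hg : PolyTime fun x : α × β × List β => g x.1 x.2.1 x.2.2) :
    PolyTime fun a => ((l a).casesOn (f a) (g a) : γ) := by
  refine comp₂ (h := fun a l => (l.casesOn (f a) (g a) : γ)) ?_ id hl
  refine of_branches (fun b => .tl (.var b)) (fun x => enc x.2) (2 * X + 2)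
    (fun b x => EvalsAt.var.tl.mono ?_) ?_ ?_
  · change 1 + encSize x + (1 + encSize x.2) ≤ _
    obtain ⟨a, l⟩ := x
    simp only [encSize_pair, eval_add, eval_mul, eval_X, eval_ofNat]
    omega
  · have hne (x : {x : α × List β // enc x.2 ≠ .leaf}) : x.1.2 ≠ [] := fun h => x.2 (by rw [h]; rfl)
    have huncons : PolyTime fun x : {x : α × List β // enc x.2 ≠ .leaf} =>
        (x.1.1, x.1.2.head (hne x), x.1.2.tail) := of_enc_eq fun ⟨⟨a, l⟩, hx⟩ => by
      cases l with
      | nil => exact absurd rfl hx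
      | cons b l => rfl
    refine congr (hg.comp huncons) fun ⟨⟨a, l⟩, hx⟩ => ?_
    cases l with
    | nil => exact absurd rfl hx
    | cons b l => rfl
  · refine congr (hf.comp (fst coe)) fun ⟨⟨a, l⟩, hx⟩ => ?_
    cases l with
    | nil => rfl
    | cons b l => cases hx

end PolyTime

/-! ### Folding over lists -/

theorem RunsAt.foldl {p : Prog} {b S T : ℕ} {step : α → γ → β → γ} {a : α}
    (hp : ∀ x l z, encSize (a, x :: l, z) ≤ S →
      RunsAt p b (enc (a, x :: l, z)) (enc (a, l, step a z x)) T) (l : List β) (z : γ)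
    (hS : ∀ l₁ l₂, l₁ ++ l₂ = l → encSize (a, l₂, l₁.foldl (step a) z) ≤ S) :
    RunsAt (.loop (.hd (.tl (.var b))) p) b (enc (a, l, z))
      (enc (a, ([] : List β), l.foldl (step a) z)) ((l.length + 1) * (T + 3 * S + 4)) := by
  have htest (l : List β) (z : γ) (hsize : encSize (a, l, z) ≤ S) :
      EvalsAt (.hd (.tl (.var b))) b (enc (a, l, z)) (enc l) (3 * S + 3) := by
    refine EvalsAt.var.tl.hd.mono ?_
    change 1 + encSize (a, l, z) + (1 + encSize (l, z)) + (1 + encSize l) ≤ _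
    simp only [encSize_pair] at hsize ⊢
    omega
  induction l generalizing z with
  | nil =>
    exact (RunsAt.loop_stop (htest [] z (hS [] [] rfl))).mono (by rw [List.length_nil]; omega)
  | cons x l ih =>
    have hsize : encSize (a, x :: l, z) ≤ S := hS [] _ rfl
    refine (RunsAt.loop_step (htest _ z hsize) BTree.noConfusion (hp x l z hsize)
      (ih (step a z x) fun l₁ l₂ h => hS (x :: l₁) l₂ (congrArg (x :: ·) h))).mono ?_
    rw [List.length_cons, add_mul (l.length + 1)]
    omega

theorem PolyTimeIn.foldl {m : α → ℕ} (hm : ∀ a, encSize a ≤ m a) {step : α → γ → β → γ}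
    {l : α → List β} {z : α → γ} (hl : PolyTimeIn m l) (hz : PolyTimeIn m z)
    (hstep : PolyTime fun x : α × γ × β => step x.1 x.2.1 x.2.2) (Q : ℕ[X])
    (hQ : ∀ a l₁, l₁ <+: l a → encSize (l₁.foldl (step a) (z a)) ≤ Q.eval (m a)) :
    PolyTimeIn m fun a => (l a).foldl (step a) (z a) := by
  suffices hloop : PolyTimeIn m fun a => (a, ([] : List β), (l a).foldl (step a) (z a)) from
    PolyTime.comp (g := fun x => x.2.2) (.snd (.snd .id)) hloop
  have hcons : PolyTime fun x : (α × List β × γ) × β × List β =>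
      (x.1.1, x.2.2, step x.1.1 x.1.2.2 x.2.1) :=
    .pair (.fst (.fst .id)) (.pair (.snd (.snd .id)) (hstep.comp (PolyTime.pair (.fst (.fst .id))
      (.pair (.snd (.snd (.fst .id))) (.fst (.snd .id))))))
  obtain ⟨R, _, hbody⟩ : PolyTime fun x : α × List β × γ =>
      (x.2.1.casesOn x fun b l => (x.1, l, step x.1 x.2.2 b) : α × List β × γ) :=
    .list_cases (g := fun x b l => (x.1, l, step x.1 x.2.2 b)) (.fst (.snd .id)) .id hcons
  obtain ⟨P, hsize, hinit⟩ := PolyTimeIn.pair hm (PolyTime.id.polyTimeIn hm) (hl.pair hm hz)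
  have hS (a : α) (l₁ l₂ : List β) (h : l₁ ++ l₂ = l a) :
      encSize (a, l₂, l₁.foldl (step a) (z a)) ≤ (P + Q).eval (m a) := by
    have ha := hsize a
    have hsub := encSize_le_of_sublist (h ▸ List.sublist_append_right l₁ l₂)
    have hpre := hQ a l₁ ⟨l₂, h⟩
    simp only [encSize_pair, eval_add] at ha ⊢
    omega
  refine ⟨P + Q + (P * (R.comp (P + Q) + 3 * (P + Q) + 4) + 1), fun a => ?_, fun b => ?_⟩
  · refine (hS a (l a) [] (List.append_nil _)).trans ?_
    rw [eval_add (p := P + Q)]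
    exact Nat.le_add_right _ _
  · obtain ⟨p, hp⟩ := hinit b
    obtain ⟨q, hq⟩ := hbody b
    have hloop (a : α) := RunsAt.foldl (fun x l z hxS =>
      (hq (a, x :: l, z)).mono (monotone_eval R hxS)) (l a) (z a) (hS a)
    refine ⟨.seq p (.loop (.hd (.tl (.var b))) q), fun a => ((hp a).seq (hloop a)).mono ?_⟩
    have hlen : (l a).length + 1 ≤ P.eval (m a) := by
      have ha := hsize a
      have hlen := length_lt_encSize (l a)
      simp only [encSize_pair] at ha
      omega
    have hrounds :=
      Nat.mul_le_mul_right (R.eval ((P + Q).eval (m a)) + 3 * (P + Q).eval (m a) + 4) hlen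
    simp only [eval_mul, eval_add, eval_comp, eval_one, eval_ofNat] at hrounds ⊢
    omega

omit [TreeEncodable β] in
theorem encSize_foldl_le {step : γ → β → γ} {l : List β} {M : ℕ}
    (h : ∀ z, ∀ b ∈ l, encSize (step z b) ≤ encSize z + M) (z : γ) :
    encSize (l.foldl step z) ≤ encSize z + l.length * M := by
  induction l generalizing z with
  | nil => simp
  | cons b l ih =>
    have hstep := h z b List.mem_cons_self
    have hl := ih (fun z b hb => h z b (List.mem_cons_of_mem _ hb)) (step z b)
    rw [List.foldl_cons, List.length_cons, add_mul]
    omega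

namespace PolyTime

theorem foldl_of_le_add {l : α → List β} {z : α → γ} {step : α → γ → β → γ} (hl : PolyTime l)
    (hz : PolyTime z) (hstep : PolyTime fun x : α × γ × β => step x.1 x.2.1 x.2.2) (Q : ℕ[X])
    (hQ : ∀ a z, ∀ b ∈ l a, encSize (step a z b) ≤ encSize z + Q.eval (encSize (a, b))) :
    PolyTime fun a => (l a).foldl (step a) (z a) := by
  obtain ⟨P, hP⟩ := hl.exists_encSize_le
  obtain ⟨R, hR⟩ := hz.exists_encSize_le
  refine PolyTimeIn.foldl (fun _ => le_rfl) hl hz hstep (R + P * Q.comp (X + P + 1))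
    fun a l₁ hl₁ => (encSize_foldl_le (M := Q.eval (encSize a + P.eval (encSize a) + 1))
      (fun z b hb => ?_) (z a)).trans ?_
  · have hbl := hl₁.subset hb
    refine (hQ a z b hbl).trans (Nat.add_le_add_left (monotone_eval Q ?_) _)
    have hb := encSize_lt_of_mem hbl
    have hla := hP a
    simp only [encSize_pair]
    omega
  · simp only [eval_add, eval_mul, eval_comp, eval_X, eval_one]
    gcongr
    · exact hR a
    · have hlen := length_lt_encSize (l a)
      have hlen₁ := hl₁.length_le
      have hla := hP a
      omega

theorem reverse {l : α → List β} (hl : PolyTime l) : PolyTime fun a => (l a).reverse :=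
  congr (foldl_of_le_add (step := fun _ z b => b :: z) hl (const []) (cons (snd (snd id))
    (fst (snd id))) (X + 1) fun a z b _ => by simp; omega) fun a => by simp

theorem foldr {l : α → List β} {z : α → γ} {step : α → β → γ → γ} (hl : PolyTime l)
    (hz : PolyTime z) (hstep : PolyTime fun x : α × β × γ => step x.1 x.2.1 x.2.2) (Q : ℕ[X])
    (hQ : ∀ a l₁, l₁ <:+ l a → encSize (l₁.foldr (step a) (z a)) ≤ Q.eval (encSize a)) :
    PolyTime fun a => (l a).foldr (step a) (z a) := by
  refine congr (PolyTimeIn.foldl (step := fun a z b => step a b z) (fun _ => le_rfl) hl.reverse hz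
    (hstep.comp (pair (fst id) (pair (snd (snd id)) (fst (snd id))))) Q fun a l₁ hl₁ => ?_)
    fun a => List.foldl_reverse
  have hsuffix := List.reverse_prefix.1 (l₁.reverse_reverse.symm ▸ hl₁)
  simpa only [List.foldr_reverse] using hQ a l₁.reverse hsuffix

theorem foldr_of_le_add {l : α → List β} {z : α → γ} {step : α → β → γ → γ} (hl : PolyTime l)
    (hz : PolyTime z) (hstep : PolyTime fun x : α × β × γ => step x.1 x.2.1 x.2.2) (Q : ℕ[X])
    (hQ : ∀ a z, ∀ b ∈ l a, encSize (step a b z) ≤ encSize z + Q.eval (encSize (a, b))) :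
    PolyTime fun a => (l a).foldr (step a) (z a) :=
  congr (foldl_of_le_add (step := fun a z b => step a b z) hl.reverse hz
    (hstep.comp (pair (fst id) (pair (snd (snd id)) (fst (snd id))))) Q fun a z b hb =>
      hQ a z b (List.mem_reverse.1 hb)) fun _ => List.foldl_reverse

theorem append {l l' : α → List β} (hl : PolyTime l) (hl' : PolyTime l') :
    PolyTime fun a => l a ++ l' a :=
  congr (foldr_of_le_add (step := fun _ b z => b :: z) hl hl' (cons (fst (snd id)) (snd (snd id)))
    (X + 1) fun a z b _ => by simp; omega) fun a => by simp

theorem flatMap {l : α → List β} {f : α → β → List γ} (hl : PolyTime l)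
    (hf : PolyTime fun x : α × β => f x.1 x.2) : PolyTime fun a => (l a).flatMap (f a) := by
  obtain ⟨P, hP⟩ := hf.exists_encSize_le
  refine congr (foldl_of_le_add (step := fun a z b => z ++ f a b) hl (const [])
    (append (fst (snd id)) (hf.comp (pair (fst id) (snd (snd id))))) P fun a z b _ => ?_)
    fun _ => List.flatMap_eq_foldl.symm
  have happend := encSize_append z (f a b)
  have hfab := hP (a, b)
  dsimp only at hfab
  omega

theorem map {l : α → List β} {f : α → β → γ} (hl : PolyTime l)
    (hf : PolyTime fun x : α × β => f x.1 x.2) : PolyTime fun a => (l a).map (f a) :=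
  congr (flatMap (f := fun a b => [f a b]) hl (cons hf (const []))) fun _ =>
    List.map_eq_flatMap.symm

theorem filter {l : α → List β} {p : α → β → Bool} (hl : PolyTime l)
    (hp : PolyTime fun x : α × β => p x.1 x.2) : PolyTime fun a => (l a).filter (p a) :=
  congr (foldr_of_le_add (step := fun a b z => if p a b then b :: z else z) hl (const [])
    (ite (hp.comp (pair (fst id) (fst (snd id)))) (cons (fst (snd id)) (snd (snd id)))
      (snd (snd id))) (X + 1) fun a z b _ => by split <;> (simp; try omega)) fun a => by
    simp [List.filter_eq_foldr, cond_eq_ite]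

theorem flatten {l : α → List (List β)} (hl : PolyTime l) : PolyTime fun a => (l a).flatten :=
  congr (flatMap (f := fun _ b => b) hl (snd id)) fun _ => List.flatMap_id'

theorem not {p : α → Bool} (hp : PolyTime p) : PolyTime fun a => !p a :=
  congr (ite hp (const false) (const true)) fun a => by simp

theorem and {p q : α → Bool} (hp : PolyTime p) (hq : PolyTime q) : PolyTime fun a => p a && q a :=
  congr (ite hp hq (const false)) fun a => by simp

theorem or {p q : α → Bool} (hp : PolyTime p) (hq : PolyTime q) : PolyTime fun a => p a || q a :=
  congr (ite hp (const true) hq) fun a => by simp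

theorem any {l : α → List β} {p : α → β → Bool} (hl : PolyTime l)
    (hp : PolyTime fun x : α × β => p x.1 x.2) : PolyTime fun a => (l a).any (p a) :=
  congr (foldr_of_le_add (step := fun a b z => p a b || z) hl (const false)
    (or (hp.comp (pair (fst id) (fst (snd id)))) (snd (snd id))) 3 fun a z b _ => by
      have hle := encSize_bool_le (p a b || z)
      simp only [eval_ofNat]
      omega) fun a => by
    generalize l a = l
    induction l with
    | nil => rfl
    | cons b l ih => rw [List.foldr_cons, ih, List.any_cons]

theorem all {l : α → List β} {p : α → β → Bool} (hl : PolyTime l)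
    (hp : PolyTime fun x : α × β => p x.1 x.2) : PolyTime fun a => (l a).all (p a) :=
  congr (not (any (p := fun a b => !p a b) hl (not hp))) fun _ => List.all_eq_not_any_not.symm

theorem mem [BEq β] [LawfulBEq β] (hβ : Function.Injective (enc : β → BTree)) {f : α → β}
    {l : α → List β} (hf : PolyTime f) (hl : PolyTime l) : PolyTime fun a => decide (f a ∈ l a) :=
  haveI : DecidableEq β := instDecidableEqOfLawfulBEq
  congr (any (p := fun a b => decide (f a = b)) hl (decide_eq hβ (hf.comp (fst id)) (snd id)))
    fun a => by simp [List.any_eq]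

theorem iterate {l : α → List β} {z : α → γ} {f : α → γ → γ} (hl : PolyTime l) (hz : PolyTime z)
    (hf : PolyTime fun x : α × γ => f x.1 x.2) (Q : ℕ[X])
    (hQ : ∀ a z, encSize (f a z) ≤ encSize z + Q.eval (encSize a)) :
    PolyTime fun a => (f a)^[(l a).length] (z a) :=
  congr (foldl_of_le_add (step := fun a z _ => f a z) hl hz
    (hf.comp (pair (fst id) (fst (snd id)))) Q fun a z _ _ => (hQ a z).trans
      (Nat.add_le_add_left (monotone_eval Q (by simp only [encSize_pair]; omega)) _))
    fun a => List.foldl_const (f a) (z a) (l a)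

end PolyTime

/-! ### Injective encodings -/

theorem encBool_injective : Function.Injective encBool := by
  rintro (_ | _) (_ | _) h <;> simp_all [encBool]

omit [TreeEncodable α] in
theorem encList_injective {e : α → BTree} (he : Function.Injective e) :
    Function.Injective (encList e) := by
  intro l l' h
  induction l generalizing l' with
  | nil => cases l' <;> simp_all [encList]
  | cons a l ih =>
    cases l' with
    | nil => simp [encList] at h
    | cons b l' =>
      obtain ⟨hhd, htl⟩ := BTree.pair.inj h
      rw [he hhd, ih htl]

theorem bits_injective : Function.Injective Nat.bits := fun m n h =>
  Nat.digits.injective 2 (by rw [Nat.digits_two_eq_bits, h, Nat.digits_two_eq_bits])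

theorem enc_nat_injective : Function.Injective (enc : ℕ → BTree) :=
  (encList_injective encBool_injective).comp bits_injective

theorem enc_list_nat_injective : Function.Injective (enc : List ℕ → BTree) :=
  encList_injective enc_nat_injective

/-! ### Binary increment -/

/-- The increment of a number in binary, least significant bit first. Bags are numbered by iterating
it. -/
def incBits : List Bool → List Bool
  | [] => [true]
  | false :: l => true :: l
  | true :: l => false :: incBits l

theorem bits_succ (n : ℕ) : (n + 1).bits = incBits n.bits := by
  induction n using Nat.binaryRec' with
  | zero => simp [incBits]
  | bit b n h ih =>
    rw [Nat.bits_append_bit _ _ h]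
    cases b with
    | false => exact Nat.bit1_bits n
    | true => rw [incBits, ← ih, ← Nat.bit0_bits (n + 1) (by omega)]; rfl

theorem encSize_incBits_le (l : List Bool) : encSize (incBits l) ≤ encSize l + 4 := by
  induction l with
  | nil => decide
  | cons b l ih =>
    cases b <;> simp only [incBits, encSize_cons] <;>
      have htrue : encSize true = 3 := rfl <;> have hfalse : encSize false = 1 := rfl <;> omega

namespace PolyTime

theorem incBits : PolyTime incBits := by
  let step (b : Bool) (z : List Bool × List Bool) : List Bool × List Bool :=
    (b :: z.1, if b then false :: z.2 else true :: z.1)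
  have hfold (l : List Bool) : l.foldr step ([], [true]) = (l, TreeProj.incBits l) := by
    induction l with
    | nil => rfl
    | cons b l ih => cases b <;> simp [step, ih, TreeProj.incBits]
  have hstep : PolyTime fun x : Bool × List Bool × List Bool => step x.1 x.2 :=
    pair (cons (fst id) (fst (snd id))) (ite (fst id) (cons (const false) (snd (snd id)))
      (cons (const true) (fst (snd id))))
  have hfoldr := foldr (step := fun _ => step) id (const ([], [true])) (hstep.comp (snd id))
    (2 * X + 5) fun l l₁ h => by
      have hl₁ := encSize_le_of_sublist h.sublist
      have hinc := encSize_incBits_le l₁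
      simp only [hfold, encSize_pair, eval_add, eval_mul, eval_X, eval_ofNat]
      omega
  exact congr (snd hfoldr) fun l => by rw [hfold]

theorem succ : PolyTime fun n : ℕ => n + 1 := by
  have hinc : PolyTime fun n : ℕ => TreeProj.incBits n.bits := incBits.comp (of_enc_eq fun _ => rfl)
  exact congr_enc hinc fun n => congrArg (encList encBool) (bits_succ n).symm

end PolyTime

end

/-! ### The algorithm -/

/-- A bag, together with a label that certifies its admissibility: the hyperedges that cover it. -/
abbrev Bag : Type := List ℕ × List (List ℕ)

/-- The vertices of a list of hyperedges. -/
def verts (E : List (List ℕ)) : List ℕ := E.flatten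

/-- Whether `u` shares a hyperedge with an element of `C`. -/
def touches (E : List (List ℕ)) (C : List ℕ) (u : ℕ) : Bool :=
  E.any fun e => decide (u ∈ e) && e.any fun w => decide (w ∈ C)

/-- One round of the search for a component of the complement of `S`: add to `R` all its neighbours
outside `S`. -/
def grow (E : List (List ℕ)) (S R : List ℕ) : List ℕ :=
  (verts E).filter fun u => decide (u ∈ R) || (!decide (u ∈ S) && touches E R u)

/-- The vertices that can be reached from `v` without entering `S`: for `v` outside `S`, the
component of `v` in the complement of `S`. As sublists of `verts E`, equal components are equal
lists. -/
def component (E : List (List ℕ)) (S : List ℕ) (v : ℕ) : List ℕ :=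
  (grow E S)^[(verts E).length] ((verts E).filter fun u => decide (u ∈ [v]))

/-- Whether `u` is a neighbour of `C` outside `C`. -/
def isNbr (E : List (List ℕ)) (C : List ℕ) (u : ℕ) : Bool :=
  !decide (u ∈ C) && touches E C u

/-- The test that `B` may be the top bag of a decomposition of the component `C`, provided that the
components listed in `T` can be decomposed: `B` contains the neighbours of `C`, is contained in `C`
and its neighbours, meets `C`, and splits `C` into components that are listed in `T`. -/
def goodBag (E T : List (List ℕ)) (C B : List ℕ) : Bool :=
  ((verts E).all fun u => !isNbr E C u || decide (u ∈ B)) &&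
    (B.all fun u => decide (u ∈ C) || isNbr E C u) &&
    (C.any fun u => decide (u ∈ B)) &&
    C.all fun v => decide (v ∈ B) || decide (component E B v ∈ T)

/-- All components of the complements of the bags in `BB`. -/
def allComponents (E : List (List ℕ)) (BB : List Bag) : List (List ℕ) :=
  BB.flatMap fun B => ((verts E).filter fun v => !decide (v ∈ B.1)).map fun v => component E B.1 v

/-- One round of the elimination of components: keep those with a good bag in `BB`. -/
def prune (E : List (List ℕ)) (BB : List Bag) (T : List (List ℕ)) : List (List ℕ) :=
  T.filter fun C => BB.any fun B => goodBag E T C B.1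

/-- The components that can be decomposed with bags in `BB`, as a greatest fixed point. -/
def solvable (E : List (List ℕ)) (BB : List Bag) : List (List ℕ) :=
  (prune E BB)^[(allComponents E BB).length] (allComponents E BB)

/-- The vertices in the bags of `L`. -/
def covered (L : List Bag) : List ℕ := (L.map fun B => B.1).flatten

/-- The bags that may be added to the partial decomposition `L`: the good bags of the components of
the uncovered vertices. -/
def nextBags (E : List (List ℕ)) (BB : List Bag) (T : List (List ℕ)) (L : List Bag) : List Bag :=
  ((verts E).filter fun v => !decide (v ∈ covered L)).flatMap fun v =>
    BB.filter fun B => goodBag E T (component E (covered L) v) B.1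

/-- Add a bag to a partial decomposition, if possible. -/
def extend (E : List (List ℕ)) (BB : List Bag) (T : List (List ℕ)) (L : List Bag) : List Bag :=
  match nextBags E BB T L with
  | [] => L
  | B :: _ => B :: L

/-- A decomposition with bags in `BB`, if there is one: a list of bags, from the last to the first,
that starts at the empty bag. -/
def decomposition (E : List (List ℕ)) (BB : List Bag) : List Bag :=
  (extend E BB (solvable E BB))^[(verts E).length] [([], [])]

/-- Whether the partial decomposition `L` covers all vertices. Since even the empty hypergraph needs
a bag, `BB` has to be nonempty. -/
def isComplete (E : List (List ℕ)) (BB L : List Bag) : Bool :=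
  (BB.any fun _ => true) && (verts E).all fun v => decide (v ∈ covered L)

theorem encSize_extend_le (E T : List (List ℕ)) (BB L : List Bag) :
    encSize (extend E BB T L) ≤ encSize L + (encSize BB + 1) := by
  unfold extend
  cases hnext : nextBags E BB T L with
  | nil => dsimp only; omega
  | cons B l =>
    have hB : B ∈ nextBags E BB T L := by simp [hnext]
    obtain ⟨v, -, hB⟩ := List.mem_flatMap.1 hB
    have hlt := encSize_lt_of_mem (List.mem_filter.1 hB).1
    simp only [encSize_cons]
    omega

namespace PolyTime

variable {α β γ : Type} [TreeEncodable α] [TreeEncodable β] [TreeEncodable γ]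

theorem comp_fst {f : α → γ} (hf : PolyTime f) : PolyTime fun x : α × β => f x.1 :=
  hf.comp (fst id)

theorem mem_nat {f : α → ℕ} {l : α → List ℕ} (hf : PolyTime f) (hl : PolyTime l) :
    PolyTime fun a => decide (f a ∈ l a) :=
  mem enc_nat_injective hf hl

theorem verts {E : α → List (List ℕ)} (hE : PolyTime E) : PolyTime fun a => verts (E a) :=
  flatten hE

theorem touches {E : α → List (List ℕ)} {C : α → List ℕ} {u : α → ℕ} (hE : PolyTime E)
    (hC : PolyTime C) (hu : PolyTime u) : PolyTime fun a => touches (E a) (C a) (u a) :=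
  any hE (and (mem_nat hu.comp_fst (snd id))
    (any (snd id) (mem_nat (snd id) hC.comp_fst.comp_fst)))

theorem grow {E : α → List (List ℕ)} {S R : α → List ℕ} (hE : PolyTime E) (hS : PolyTime S)
    (hR : PolyTime R) : PolyTime fun a => grow (E a) (S a) (R a) :=
  filter hE.verts (or (mem_nat (snd id) hR.comp_fst)
    (and (not (mem_nat (snd id) hS.comp_fst)) (touches hE.comp_fst hR.comp_fst (snd id))))

theorem component {E : α → List (List ℕ)} {S : α → List ℕ} {v : α → ℕ} (hE : PolyTime E)
    (hS : PolyTime S) (hv : PolyTime v) : PolyTime fun a => component (E a) (S a) (v a) := by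
  obtain ⟨P, hP⟩ := hE.verts.exists_encSize_le
  exact iterate (f := fun a R => TreeProj.grow (E a) (S a) R) hE.verts
    (filter hE.verts (mem_nat (snd id) (cons hv.comp_fst (const []))))
    (grow hE.comp_fst hS.comp_fst (snd id)) P fun a z =>
      ((encSize_le_of_sublist List.filter_sublist).trans (hP a)).trans (Nat.le_add_left _ _)

theorem isNbr {E : α → List (List ℕ)} {C : α → List ℕ} {u : α → ℕ} (hE : PolyTime E)
    (hC : PolyTime C) (hu : PolyTime u) : PolyTime fun a => isNbr (E a) (C a) (u a) :=
  and (not (mem_nat hu hC)) (touches hE hC hu)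

theorem goodBag {E T : α → List (List ℕ)} {C B : α → List ℕ} (hE : PolyTime E) (hT : PolyTime T)
    (hC : PolyTime C) (hB : PolyTime B) : PolyTime fun a => goodBag (E a) (T a) (C a) (B a) :=
  and (and (and
    (all hE.verts
      (or (not (isNbr hE.comp_fst hC.comp_fst (snd id))) (mem_nat (snd id) hB.comp_fst)))
    (all hB (or (mem_nat (snd id) hC.comp_fst) (isNbr hE.comp_fst hC.comp_fst (snd id)))))
    (any hC (mem_nat (snd id) hB.comp_fst)))
    (all hC (or (mem_nat (snd id) hB.comp_fst)
      (mem enc_list_nat_injective (component hE.comp_fst hB.comp_fst (snd id)) hT.comp_fst)))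

theorem allComponents {E : α → List (List ℕ)} {BB : α → List Bag} (hE : PolyTime E)
    (hBB : PolyTime BB) : PolyTime fun a => allComponents (E a) (BB a) :=
  flatMap hBB (map (filter hE.comp_fst.verts (not (mem_nat (snd id) (fst (snd (fst id))))))
    (component hE.comp_fst.comp_fst (fst (snd (fst id))) (snd id)))

theorem prune {E T : α → List (List ℕ)} {BB : α → List Bag} (hE : PolyTime E)
    (hBB : PolyTime BB) (hT : PolyTime T) : PolyTime fun a => prune (E a) (BB a) (T a) :=
  filter hT (any hBB.comp_fst
    (goodBag hE.comp_fst.comp_fst hT.comp_fst.comp_fst (snd (fst id)) (fst (snd id))))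

theorem solvable {E : α → List (List ℕ)} {BB : α → List Bag} (hE : PolyTime E)
    (hBB : PolyTime BB) : PolyTime fun a => solvable (E a) (BB a) :=
  iterate (f := fun a T => TreeProj.prune (E a) (BB a) T) (allComponents hE hBB)
    (allComponents hE hBB) (prune hE.comp_fst hBB.comp_fst (snd id)) 0
    fun _ _ => (encSize_le_of_sublist List.filter_sublist).trans (Nat.le_add_right _ _)

theorem covered {L : α → List Bag} (hL : PolyTime L) : PolyTime fun a => covered (L a) :=
  flatten (map hL (fst (snd id)))

theorem nextBags {E T : α → List (List ℕ)} {BB L : α → List Bag} (hE : PolyTime E)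
    (hBB : PolyTime BB) (hT : PolyTime T) (hL : PolyTime L) :
    PolyTime fun a => nextBags (E a) (BB a) (T a) (L a) :=
  flatMap (filter hE.verts (not (mem_nat (snd id) hL.covered.comp_fst)))
    (filter hBB.comp_fst (goodBag hE.comp_fst.comp_fst hT.comp_fst.comp_fst
      (component hE.comp_fst.comp_fst hL.covered.comp_fst.comp_fst (snd (fst id)))
      (fst (snd id))))

theorem extend {E T : α → List (List ℕ)} {BB L : α → List Bag} (hE : PolyTime E)
    (hBB : PolyTime BB) (hT : PolyTime T) (hL : PolyTime L) :
    PolyTime fun a => extend (E a) (BB a) (T a) (L a) :=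
  congr (list_cases (g := fun a B _ => B :: L a) (nextBags hE hBB hT hL) hL
    (cons (fst (snd id)) hL.comp_fst)) fun a => by
    unfold TreeProj.extend
    cases TreeProj.nextBags (E a) (BB a) (T a) (L a) <;> rfl

theorem decomposition {E : α → List (List ℕ)} {BB : α → List Bag} (hE : PolyTime E)
    (hBB : PolyTime BB) : PolyTime fun a => decomposition (E a) (BB a) := by
  obtain ⟨P, hP⟩ := hBB.exists_encSize_le
  exact iterate (f := fun a L => TreeProj.extend (E a) (BB a) (TreeProj.solvable (E a) (BB a)) L)
    hE.verts (const _) (extend hE.comp_fst hBB.comp_fst (solvable hE hBB).comp_fst (snd id))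
    (P + 1) fun a L => (encSize_extend_le _ _ _ _).trans (by simpa using hP a)

theorem isComplete {E : α → List (List ℕ)} {BB L : α → List Bag} (hE : PolyTime E)
    (hBB : PolyTime BB) (hL : PolyTime L) :
    PolyTime fun a => isComplete (E a) (BB a) (L a) :=
  and (any hBB (const _)) (all hE.verts (mem_nat (snd id) hL.covered.comp_fst))

end PolyTime

/-! ### Components -/

theorem iterate_reaches {σ : Type*} {f : σ → σ} (μ : σ → ℕ) (K : σ → Prop)
    (hlt : ∀ s, K s ∨ μ (f s) < μ s) (hK : ∀ s, K s → K (f s)) {n : ℕ} {s : σ} (hn : μ s ≤ n) :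
    K (f^[n] s) := by
  induction n generalizing s with
  | zero => exact (hlt s).resolve_right (by omega)
  | succ n ih =>
    rcases hlt s with hs | hs
    · exact Function.Iterate.rec K hs hK _
    · exact ih (by omega)

theorem length_filter_lt {α : Type*} {p q : α → Bool} {l : List α}
    (hpq : ∀ x ∈ l, p x = true → q x = true) {x : α} (hx : x ∈ l) (hq : q x = true)
    (hp : p x = false) : (l.filter p).length < (l.filter q).length := by
  have hfilter : l.filter p = (l.filter q).filter p := by
    rw [List.filter_filter]
    exact List.filter_congr fun y hy => by cases hpy : p y <;> simp_all
  rw [hfilter, List.length_filter_lt_length_iff_exists]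
  exact ⟨x, List.mem_filter.2 ⟨hx, hq⟩, by simp [hp]⟩

section

variable {E : List (List ℕ)}

/-- Adjacency in the primal graph of a hypergraph: the two vertices lie on a common hyperedge. -/
def Adjacent (E : List (List ℕ)) (x y : ℕ) : Prop := ∃ e ∈ E, x ∈ e ∧ y ∈ e

theorem Adjacent.symm {x y : ℕ} : Adjacent E x y → Adjacent E y x :=
  fun ⟨e, he, hx, hy⟩ => ⟨e, he, hy, hx⟩

theorem mem_verts {x : ℕ} : x ∈ verts E ↔ ∃ e ∈ E, x ∈ e := by simp [verts]

theorem Adjacent.mem_verts {x y : ℕ} : Adjacent E x y → y ∈ verts E :=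
  fun ⟨e, he, _, hy⟩ => TreeProj.mem_verts.2 ⟨e, he, hy⟩

theorem touches_iff {C : List ℕ} {u : ℕ} : touches E C u = true ↔ ∃ w ∈ C, Adjacent E w u := by
  simp only [touches, Adjacent, List.any_eq_true, Bool.and_eq_true, decide_eq_true_eq]
  constructor
  · rintro ⟨e, he, hu, w, hw, hC⟩
    exact ⟨w, hC, e, he, hw, hu⟩
  · rintro ⟨w, hC, e, he, hw, hu⟩
    exact ⟨e, he, hu, w, hw, hC⟩

theorem mem_grow {S R : List ℕ} {u : ℕ} : u ∈ grow E S R ↔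
    u ∈ verts E ∧ (u ∈ R ∨ u ∉ S ∧ ∃ w ∈ R, Adjacent E w u) := by
  simp [grow, touches_iff]

/-- Reachability in the primal graph without entering `S`; the start vertex may lie in `S`. -/
def Reach (E : List (List ℕ)) (S : List ℕ) : ℕ → ℕ → Prop :=
  Relation.ReflTransGen fun x y => Adjacent E x y ∧ y ∉ S

theorem Reach.mono {S S' : List ℕ} (hS : ∀ x ∈ S, x ∈ S') {v u : ℕ} (h : Reach E S' v u) :
    Reach E S v u :=
  Relation.ReflTransGen.mono (fun _ _ hxy => ⟨hxy.1, fun hy => hxy.2 (hS _ hy)⟩) _ _ h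

theorem self_mem_component {S : List ℕ} {v : ℕ} (hv : v ∈ verts E) : v ∈ component E S v :=
  Function.Iterate.rec (v ∈ ·) (by simpa using hv) (fun _ hR => mem_grow.2 ⟨hv, .inl hR⟩) _

theorem reach_of_mem_component {S : List ℕ} {v u : ℕ} (hu : u ∈ component E S v) :
    Reach E S v u := by
  refine Function.Iterate.rec (fun R => ∀ u ∈ R, Reach E S v u) (fun u hu => ?_)
    (fun R hR u hu => ?_) (verts E).length u hu
  · obtain ⟨-, rfl⟩ : u ∈ verts E ∧ u = v := by simpa using hu
    exact .refl
  · obtain ⟨-, hu | ⟨hS, w, hw, hwu⟩⟩ := mem_grow.1 hu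
    · exact hR u hu
    · exact (hR w hw).tail ⟨hwu, hS⟩

/-- As long as it is not closed, the set computed by `grow` gains a vertex in every round. -/
theorem mem_component_of_adjacent {S : List ℕ} {v w u : ℕ} (hw : w ∈ component E S v)
    (hwu : Adjacent E w u) (hu : u ∉ S) : u ∈ component E S v := by
  suffices hclosed : ∀ u ∈ verts E, u ∉ S → (∃ w ∈ component E S v, Adjacent E w u) →
      u ∈ component E S v from hclosed u hwu.mem_verts hu ⟨w, hw, hwu⟩
  refine iterate_reaches (fun R => ((verts E).filter fun u => decide (u ∉ R)).length)
    (fun R => ∀ u ∈ verts E, u ∉ S → (∃ w ∈ R, Adjacent E w u) → u ∈ R) (fun R => ?_)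
    (fun R hR u hu hS ⟨w, hw, hwu⟩ => ?_) (List.length_filter_le _ _)
  · refine or_iff_not_imp_left.2 fun hR => ?_
    push Not at hR
    obtain ⟨u, hu, hS, hadj, huR⟩ := hR
    refine length_filter_lt (fun x hx hxR => ?_) hu (by simpa using huR) ?_
    · simp only [decide_eq_true_eq] at hxR ⊢
      exact fun hx' => hxR (mem_grow.2 ⟨hx, .inl hx'⟩)
    · simpa only [decide_eq_false_iff_not, not_not] using mem_grow.2 ⟨hu, .inr ⟨hS, hadj⟩⟩
  · refine mem_grow.2 ⟨hu, .inl (hR u hu hS ⟨w, ?_, hwu⟩)⟩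
    obtain ⟨hwV, hwR | ⟨hwS, hadj⟩⟩ := mem_grow.1 hw
    · exact hwR
    · exact hR w hwV hwS hadj

theorem mem_component {S : List ℕ} {v u : ℕ} (hv : v ∈ verts E) :
    u ∈ component E S v ↔ Reach E S v u := by
  refine ⟨reach_of_mem_component, fun h => ?_⟩
  induction h with
  | refl => exact self_mem_component hv
  | tail _ h ih => exact mem_component_of_adjacent ih h.1 h.2

theorem exists_component_eq_filter (S : List ℕ) (v : ℕ) :
    ∃ p : ℕ → Bool, component E S v = (verts E).filter p :=
  Function.Iterate.rec (fun R => ∃ p : ℕ → Bool, R = (verts E).filter p) ⟨_, rfl⟩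
    (fun _ _ => ⟨_, rfl⟩) _

theorem component_subset {S : List ℕ} {v u : ℕ} (hu : u ∈ component E S v) : u ∈ verts E := by
  obtain ⟨p, hp⟩ := exists_component_eq_filter (E := E) S v
  exact (List.mem_filter.1 (hp ▸ hu)).1

theorem component_congr {S S' : List ℕ} {v : ℕ} (hv : v ∈ verts E)
    (hSS' : ∀ u, Reach E S v u ↔ Reach E S' v u) : component E S v = component E S' v := by
  have hmem : ∀ u, u ∈ component E S v ↔ u ∈ component E S' v := fun u =>
    (mem_component hv).trans ((hSS' u).trans (mem_component hv).symm)
  obtain ⟨p, hp⟩ := exists_component_eq_filter (E := E) S v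
  obtain ⟨p', hp'⟩ := exists_component_eq_filter (E := E) S' v
  simp only [hp, hp', List.mem_filter, and_congr_right_iff] at hmem ⊢
  exact List.filter_congr fun u hu => Bool.eq_iff_iff.2 (hmem u hu)

theorem notMem_of_mem_component {S : List ℕ} {v u : ℕ} (hv : v ∉ S)
    (hu : u ∈ component E S v) : u ∉ S := by
  rcases reach_of_mem_component hu with _ | ⟨-, h⟩
  exacts [hv, h.2]

/-- `u` lies on the boundary of `C`: it is a neighbour of `C` outside `C`. -/
def IsBoundary (E : List (List ℕ)) (C : List ℕ) (u : ℕ) : Prop :=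
  u ∉ C ∧ ∃ w ∈ C, Adjacent E w u

theorem isNbr_iff {C : List ℕ} {u : ℕ} : isNbr E C u = true ↔ IsBoundary E C u := by
  simp [isNbr, touches_iff, IsBoundary]

theorem IsBoundary.mem_verts {C : List ℕ} {u : ℕ} (hu : IsBoundary E C u) : u ∈ verts E :=
  let ⟨_, _, hadj⟩ := hu.2
  hadj.mem_verts

theorem IsBoundary.mem {S : List ℕ} {v u : ℕ} (hu : IsBoundary E (component E S v) u) : u ∈ S := by
  by_contra hS
  obtain ⟨huC, w, hw, hwu⟩ := hu
  exact huC (mem_component_of_adjacent hw hwu hS)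

/-- The property of bags tested by `goodBag`. -/
structure IsGoodBag (E T : List (List ℕ)) (C B : List ℕ) : Prop where
  boundary_subset : ∀ u, IsBoundary E C u → u ∈ B
  subset_closure : ∀ u ∈ B, u ∈ C ∨ IsBoundary E C u
  exists_mem : ∃ u ∈ C, u ∈ B
  component_mem : ∀ v ∈ C, v ∉ B → component E B v ∈ T

theorem goodBag_iff {T : List (List ℕ)} {C B : List ℕ} :
    goodBag E T C B = true ↔ IsGoodBag E T C B := by
  have hboundary : (∀ u ∈ verts E, ¬ IsBoundary E C u ∨ u ∈ B) ↔
      ∀ u, IsBoundary E C u → u ∈ B :=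
    ⟨fun h u hu => (h u hu.mem_verts).resolve_left (not_not.2 hu), fun h u _ =>
      not_or_of_imp (h u)⟩
  have hgood : IsGoodBag E T C B ↔ (∀ u, IsBoundary E C u → u ∈ B) ∧
      (∀ u ∈ B, u ∈ C ∨ IsBoundary E C u) ∧ (∃ u ∈ C, u ∈ B) ∧
      ∀ v ∈ C, v ∉ B → component E B v ∈ T :=
    ⟨fun ⟨hN, hB, hC, hT⟩ => ⟨hN, hB, hC, hT⟩, fun ⟨hN, hB, hC, hT⟩ => ⟨hN, hB, hC, hT⟩⟩
  rw [hgood, ← hboundary]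
  simp only [goodBag, Bool.and_eq_true, List.all_eq_true, List.any_eq_true, Bool.or_eq_true,
    decide_eq_true_eq, Bool.not_eq_true', ← Bool.not_eq_true, isNbr_iff, and_assoc,
    ← or_iff_not_imp_left]

theorem reach_of_boundary_subset {B U C : List ℕ} {v u : ℕ} (hC : ∀ u ∈ C, u ∉ U)
    (hN : ∀ u, IsBoundary E C u → u ∈ B) (hv : v ∈ C) (h : Reach E B v u) :
    u ∈ C ∧ Reach E (B ++ U) v u := by
  induction h with
  | refl => exact ⟨hv, .refl⟩
  | @tail x y _ h ih =>
    have hy : y ∈ C := by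
      by_contra hy
      exact h.2 (hN y ⟨hy, x, ih.1, h.1⟩)
    exact ⟨hy, ih.2.tail ⟨h.1, by simp [h.2, hC y hy]⟩⟩

theorem component_append_of_mem {B U : List ℕ} {v₀ v : ℕ} (hU : v₀ ∉ U)
    (hN : ∀ u, IsBoundary E (component E U v₀) u → u ∈ B) (hv : v ∈ component E U v₀) :
    component E (B ++ U) v = component E B v :=
  component_congr (component_subset hv) fun u =>
    ⟨Reach.mono (by simp +contextual), fun h => (reach_of_boundary_subset
      (fun _ => notMem_of_mem_component hU) hN hv h).2⟩

theorem component_append_of_notMem {B U : List ℕ} {v₀ v : ℕ}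
    (hB : ∀ u ∈ B, u ∈ component E U v₀ ∨ IsBoundary E (component E U v₀) u)
    (hv : v ∈ verts E) (hvU : v ∉ U) (hvC : v ∉ component E U v₀) :
    component E (B ++ U) v = component E U v := by
  refine component_congr hv fun u => ⟨Reach.mono (by simp +contextual), fun h => ?_⟩
  suffices hinv : u ∉ U ∧ u ∉ component E U v₀ ∧ Reach E (B ++ U) v u from hinv.2.2
  induction h with
  | refl => exact ⟨hvU, hvC, .refl⟩
  | @tail x y _ h ih =>
    have hy : y ∉ component E U v₀ := fun hy => ih.1 (IsBoundary.mem ⟨ih.2.1, y, hy, h.1.symm⟩)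
    refine ⟨h.2, hy, ih.2.2.tail ⟨h.1, ?_⟩⟩
    rw [List.mem_append, not_or]
    exact ⟨fun hyB => (hB y hyB).elim hy fun hbd => h.2 hbd.mem, h.2⟩

theorem IsGoodBag.component_append {T : List (List ℕ)} {B U : List ℕ} {v₀ v : ℕ}
    (hB : IsGoodBag E T (component E U v₀) B) (hU : v₀ ∉ U) (hv : v ∈ verts E)
    (hvBU : v ∉ B ++ U) :
    v ∈ component E U v₀ ∧ component E (B ++ U) v = component E B v ∨
      component E (B ++ U) v = component E U v := by
  by_cases hvC : v ∈ component E U v₀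
  · exact .inl ⟨hvC, component_append_of_mem hU hB.boundary_subset hvC⟩
  · exact .inr (component_append_of_notMem hB.subset_closure hv
      (fun hvU => hvBU (List.mem_append_right B hvU)) hvC)

theorem IsGoodBag.subset_of_edge {T : List (List ℕ)} {B U e : List ℕ} {v₀ x : ℕ}
    (hB : IsGoodBag E T (component E U v₀) B) (hU : v₀ ∉ U) (he : e ∈ E) (hx : x ∈ e)
    (hxU : x ∉ U) (heBU : ∀ y ∈ e, y ∈ B ++ U) : ∀ y ∈ e, y ∈ B := by
  have hmem : ∀ y ∈ e, y ∉ U → y ∈ B := fun y hy hyU =>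
    (List.mem_append.1 (heBU y hy)).resolve_right hyU
  have hxC : x ∈ component E U v₀ :=
    (hB.subset_closure x (hmem x hx hxU)).resolve_right fun hbd => hxU hbd.mem
  intro y hy
  by_cases hyC : y ∈ component E U v₀
  · exact hmem y hy (notMem_of_mem_component hU hyC)
  · exact hB.boundary_subset y ⟨hyC, x, hxC, e, he, hx, hy⟩

/-! ### Soundness of the greedy decomposition -/

/-- The running intersection property, for lists of bags from the last to the first: what a bag
shares with the preceding ones lies in a single one of them. The first bag is empty, and each later
bag has a new vertex, so the number of bags is bounded. -/
inductive RunningIntersection : List Bag → Prop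
  | base : RunningIntersection [([], [])]
  | step {L : List Bag} {B : Bag} : RunningIntersection L →
      (∃ B' ∈ L, ∀ x ∈ B.1, x ∈ covered L → x ∈ B'.1) → (∃ x ∈ B.1, x ∉ covered L) →
      RunningIntersection (B :: L)

/-- The invariant of the greedy construction: `L` is a decomposition of the hypergraph induced on
the vertices covered so far, and each component of the remaining vertices is attached to a single
bag. -/
structure IsPartial (E : List (List ℕ)) (BB L : List Bag) : Prop where
  runningIntersection : RunningIntersection L
  mem : ∀ B ∈ L, B = ([], []) ∨ B ∈ BB
  mem_verts : ∀ B ∈ L, ∀ x ∈ B.1, x ∈ verts E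
  edge : ∀ e ∈ E, (∃ x ∈ e, x ∉ covered L) ∨ ∃ B ∈ L, ∀ x ∈ e, x ∈ B.1
  boundary : ∀ v ∈ verts E, v ∉ covered L →
    ∃ B ∈ L, ∀ u, IsBoundary E (component E (covered L) v) u → u ∈ B.1

theorem isPartial_singleton (BB : List Bag) : IsPartial E BB [([], [])] where
  runningIntersection := .base
  mem := by simp
  mem_verts := by simp
  edge e _ := by
    cases e with
    | nil => exact .inr ⟨_, List.mem_singleton_self _, by simp⟩
    | cons x e => exact .inl ⟨x, by simp, by simp [covered]⟩
  boundary v _ _ := ⟨_, List.mem_singleton_self _, fun u hu => by simpa [covered] using hu.mem⟩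

theorem covered_cons (B : Bag) (L : List Bag) : covered (B :: L) = B.1 ++ covered L := rfl

theorem mem_nextBags {T : List (List ℕ)} {BB L : List Bag} {B : Bag} :
    B ∈ nextBags E BB T L ↔ ∃ v ∈ verts E, v ∉ covered L ∧ B ∈ BB ∧
      IsGoodBag E T (component E (covered L) v) B.1 := by
  simp [nextBags, goodBag_iff, and_assoc]

theorem exists_mem_of_mem_nextBags {T : List (List ℕ)} {BB L : List Bag} {B : Bag}
    (hB : B ∈ nextBags E BB T L) : ∃ w ∈ verts E, w ∈ B.1 ∧ w ∉ covered L := by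
  obtain ⟨v₀, -, hU, -, hgood⟩ := mem_nextBags.1 hB
  obtain ⟨w, hwC, hwB⟩ := hgood.exists_mem
  exact ⟨w, component_subset hwC, hwB, notMem_of_mem_component hU hwC⟩

theorem RunningIntersection.cons_nextBag {T : List (List ℕ)} {BB L : List Bag} {B : Bag}
    (hL : IsPartial E BB L) (hB : B ∈ nextBags E BB T L) : RunningIntersection (B :: L) := by
  obtain ⟨v₀, hv₀, hU, -, hgood⟩ := mem_nextBags.1 hB
  obtain ⟨w, -, hw⟩ := exists_mem_of_mem_nextBags hB
  obtain ⟨B', hB', hbd⟩ := hL.boundary v₀ hv₀ hU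
  exact .step hL.runningIntersection ⟨B', hB', fun x hx hxU => (hgood.subset_closure x hx).elim
    (fun hxC => absurd hxU (notMem_of_mem_component hU hxC)) (hbd x)⟩ ⟨w, hw⟩

theorem IsPartial.cons {T : List (List ℕ)} {BB L : List Bag} {B : Bag} (hL : IsPartial E BB L)
    (hB : B ∈ nextBags E BB T L) : IsPartial E BB (B :: L) := by
  obtain ⟨v₀, -, hU, hBB, hgood⟩ := mem_nextBags.1 hB
  constructor
  case runningIntersection => exact .cons_nextBag hL hB
  case mem => exact List.forall_mem_cons.2 ⟨.inr hBB, hL.mem⟩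
  case mem_verts =>
    exact List.forall_mem_cons.2 ⟨fun x hx => (hgood.subset_closure x hx).elim component_subset
      IsBoundary.mem_verts, hL.mem_verts⟩
  case edge =>
    intro e he
    refine or_iff_not_imp_left.2 fun hnew => ?_
    push Not at hnew
    rcases hL.edge e he with ⟨x, hx, hxU⟩ | ⟨B', hB', heB'⟩
    · exact ⟨B, List.mem_cons_self, hgood.subset_of_edge hU he hx hxU hnew⟩
    · exact ⟨B', List.mem_cons_of_mem B hB', heB'⟩
  case boundary =>
    intro v hv hvBU
    rw [covered_cons] at hvBU ⊢
    rcases hgood.component_append hU hv hvBU with ⟨-, heq⟩ | heq <;> rw [heq]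
    · exact ⟨B, List.mem_cons_self, fun u hu => hu.mem⟩
    · obtain ⟨B', hB', hbd⟩ :=
        hL.boundary v hv fun hvU => hvBU (List.mem_append_right B.1 hvU)
      exact ⟨B', List.mem_cons_of_mem B hB', hbd⟩

theorem extend_cases (E T : List (List ℕ)) (BB L : List Bag) :
    (nextBags E BB T L = [] ∧ extend E BB T L = L) ∨
      ∃ B ∈ nextBags E BB T L, extend E BB T L = B :: L := by
  unfold extend
  cases hnext : nextBags E BB T L with
  | nil => exact .inl ⟨rfl, rfl⟩
  | cons B l => exact .inr ⟨B, by simp, rfl⟩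

theorem isPartial_decomposition (E : List (List ℕ)) (BB : List Bag) :
    IsPartial E BB (decomposition E BB) := by
  refine Function.Iterate.rec (IsPartial E BB) (isPartial_singleton BB) (fun L hL => ?_) _
  rcases extend_cases E (solvable E BB) BB L with ⟨-, heq⟩ | ⟨B, hB, heq⟩ <;> rw [heq]
  exacts [hL, hL.cons hB]

theorem isComplete_iff {BB L : List Bag} :
    isComplete E BB L = true ↔ BB ≠ [] ∧ ∀ v ∈ verts E, v ∈ covered L := by
  cases BB <;> simp [isComplete]

theorem nextBags_decomposition (E : List (List ℕ)) (BB : List Bag) :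
    nextBags E BB (solvable E BB) (decomposition E BB) = [] := by
  refine iterate_reaches (fun L => ((verts E).filter fun u => decide (u ∉ covered L)).length)
    (fun L => nextBags E BB (solvable E BB) L = []) (fun L => ?_) (fun L hL => ?_)
    (List.length_filter_le _ _)
  · rcases extend_cases E (solvable E BB) BB L with ⟨hnext, -⟩ | ⟨B, hB, heq⟩
    · exact .inl hnext
    · obtain ⟨w, hw, hwB, hwU⟩ := exists_mem_of_mem_nextBags hB
      rw [heq, covered_cons]
      exact .inr (length_filter_lt (fun x _ => by simp) hw (by simpa using hwU) (by simp [hwB]))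
  · rcases extend_cases E (solvable E BB) BB L with ⟨hnext, heq⟩ | ⟨B, hB, -⟩
    · rw [heq, hnext]
    · simp [hL] at hB

theorem prune_solvable (E : List (List ℕ)) (BB : List Bag) :
    prune E BB (solvable E BB) = solvable E BB := by
  refine iterate_reaches List.length (fun T => prune E BB T = T) (fun T => ?_)
    (fun T hT => by rw [hT, hT]) le_rfl
  by_cases hlength : (prune E BB T).length = T.length
  · exact .inl (List.filter_sublist.eq_of_length hlength)
  · exact .inr (lt_of_le_of_ne (List.length_filter_le _ _) hlength)

theorem exists_isGoodBag_of_mem_solvable {BB : List Bag} {C : List ℕ} (hC : C ∈ solvable E BB) :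
    ∃ B ∈ BB, IsGoodBag E (solvable E BB) C B.1 := by
  rw [← prune_solvable] at hC
  simpa [goodBag_iff] using (List.mem_filter.1 hC).2

theorem component_decomposition_mem_solvable {BB : List Bag}
    (hsolvable : ∀ v ∈ verts E, component E [] v ∈ solvable E BB) {v : ℕ} (hv : v ∈ verts E)
    (hvU : v ∉ covered (decomposition E BB)) :
    component E (covered (decomposition E BB)) v ∈ solvable E BB := by
  refine Function.Iterate.rec (fun L => ∀ v ∈ verts E, v ∉ covered L →
    component E (covered L) v ∈ solvable E BB)
    (fun v hv _ => by simpa [covered] using hsolvable v hv) (fun L hL => ?_) _ v hv hvU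
  rcases extend_cases E (solvable E BB) BB L with ⟨-, heq⟩ | ⟨B, hB, heq⟩ <;> rw [heq]
  · exact hL
  · obtain ⟨v₀, -, hU, -, hgood⟩ := mem_nextBags.1 hB
    rw [covered_cons]
    intro v hv hvBU
    rw [List.mem_append, not_or] at hvBU
    rcases hgood.component_append hU hv (by simpa using hvBU) with ⟨hvC, heq⟩ | heq <;> rw [heq]
    · exact hgood.component_mem v hvC hvBU.1
    · exact hL v hv hvBU.2

theorem covered_decomposition {BB : List Bag}
    (hsolvable : ∀ v ∈ verts E, component E [] v ∈ solvable E BB) {v : ℕ} (hv : v ∈ verts E) :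
    v ∈ covered (decomposition E BB) := by
  by_contra hvU
  obtain ⟨B, hB, hgood⟩ := exists_isGoodBag_of_mem_solvable
    (component_decomposition_mem_solvable hsolvable hv hvU)
  have hnext := mem_nextBags.2 ⟨v, hv, hvU, hB, hgood⟩
  simp [nextBags_decomposition] at hnext

/-! ### Completeness of the greedy decomposition -/

/-- A sequence of bags with the running intersection property, `par i` being the index of an earlier
bag that contains all that the bag `i` shares with the earlier bags. It is infinite for convenience:
almost all bags may be empty. -/
structure BagSequence where
  bag : ℕ → Set ℕ
  par : ℕ → ℕ
  par_lt : ∀ i, 0 < i → par i < i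
  mem_par : ∀ i, 0 < i → ∀ x ∈ bag i, ∀ j < i, x ∈ bag j → x ∈ bag (par i)

namespace BagSequence

variable (D : BagSequence)

/-- `s` is `t` or an ancestor of `t` in the tree given by `par`. -/
def Anc : ℕ → ℕ → Prop := Relation.ReflTransGen fun t s => 0 < t ∧ s = D.par t

/-- The index of the first bag that contains `x`; it is `0` if there is none. -/
noncomputable def first (x : ℕ) : ℕ := sInf {i | x ∈ D.bag i}

variable {D}

theorem first_le {x i : ℕ} (hx : x ∈ D.bag i) : D.first x ≤ i := Nat.sInf_le hx

theorem mem_first {x i : ℕ} (hx : x ∈ D.bag i) : x ∈ D.bag (D.first x) :=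
  Nat.sInf_mem (s := {i | x ∈ D.bag i}) ⟨i, hx⟩

theorem Anc.le {t s : ℕ} (h : D.Anc t s) : s ≤ t := by
  induction h with
  | refl => exact le_rfl
  | @tail x y _ h ih => exact (h.2 ▸ (D.par_lt x h.1).le).trans ih

theorem Anc.mem {t s j x : ℕ} (h : D.Anc t s) (hx : x ∈ D.bag t) (hj : x ∈ D.bag j)
    (hjs : j ≤ s) : x ∈ D.bag s := by
  induction h with
  | refl => exact hx
  | @tail y z _ h ih =>
    have hlt := D.par_lt y h.1
    rw [h.2] at hjs ⊢
    exact D.mem_par y h.1 x (ih (by omega)) j (by omega) hj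

theorem anc_first {t x : ℕ} (hx : x ∈ D.bag t) : D.Anc t (D.first x) := by
  induction t using Nat.strong_induction_on with
  | _ t ih =>
    rcases (first_le hx).eq_or_lt with heq | hlt
    · rw [heq]; exact .refl
    · have ht : 0 < t := by omega
      exact .head ⟨ht, rfl⟩ (ih _ (D.par_lt t ht) (D.mem_par t ht x hx _ hlt (mem_first hx)))

theorem Anc.of_le {t a b : ℕ} (ha : D.Anc t a) (hb : D.Anc t b) (hab : a ≤ b) : D.Anc b a := by
  rcases Relation.ReflTransGen.total_of_right_unique
    (fun x y z hy hz => hy.2.trans hz.2.symm) ha hb with h | h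
  · rw [hab.antisymm (Anc.le h)]
    exact .refl
  · exact h

variable {BB : List Bag}

/-- `D` is a decomposition of the hypergraph `E` such that all subsets of its bags are in `BB`. -/
structure Decomposes (D : BagSequence) (E : List (List ℕ)) (BB : List Bag) : Prop where
  edge : ∀ e ∈ E, ∃ i, ∀ x ∈ e, x ∈ D.bag i
  subset : ∀ i, ∀ S ⊆ D.bag i, ∃ B ∈ BB, ∀ x, x ∈ B.1 ↔ x ∈ S

theorem Decomposes.mem_bag_first (hD : D.Decomposes E BB) {x : ℕ} (hx : x ∈ verts E) :
    x ∈ D.bag (D.first x) := by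
  obtain ⟨e, he, hxe⟩ := mem_verts.1 hx
  obtain ⟨i, hi⟩ := hD.edge e he
  exact mem_first (hi x hxe)

theorem Decomposes.anc_of_adjacent (hD : D.Decomposes E BB) {x y q : ℕ} (hxy : Adjacent E x y)
    (hx : D.Anc (D.first x) q) (hq : q ≤ D.first y) : D.Anc (D.first y) q := by
  obtain ⟨e, he, hxe, hye⟩ := hxy
  obtain ⟨i, hi⟩ := hD.edge e he
  exact Anc.of_le ((anc_first (hi x hxe)).trans hx) (anc_first (hi y hye)) hq

theorem Decomposes.anc_of_mem_component (hD : D.Decomposes E BB) {S : List ℕ} {v₀ w₀ x : ℕ}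
    (hv₀ : v₀ ∈ verts E) (hw₀ : w₀ ∈ component E S v₀)
    (hmin : ∀ w ∈ component E S v₀, D.first w₀ ≤ D.first w) (hx : x ∈ component E S v₀) :
    D.Anc (D.first x) (D.first w₀) := by
  have hconn : ∀ x, Reach E S v₀ x →
      (D.Anc (D.first v₀) (D.first w₀) ↔ D.Anc (D.first x) (D.first w₀)) := by
    intro x hx
    induction hx with
    | refl => exact Iff.rfl
    | @tail x y hx h ih =>
      have hxC : x ∈ component E S v₀ := (mem_component hv₀).2 hx
      have hyC : y ∈ component E S v₀ := (mem_component hv₀).2 (hx.tail h)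
      exact ih.trans ⟨fun hanc => hD.anc_of_adjacent h.1 hanc (hmin y hyC), fun hanc =>
        hD.anc_of_adjacent h.1.symm hanc (hmin x hxC)⟩
  exact (hconn x (reach_of_mem_component hx)).1 ((hconn w₀ (reach_of_mem_component hw₀)).2 .refl)

theorem Decomposes.mem_bag_of_isBoundary (hD : D.Decomposes E BB) {C : List ℕ} {q u : ℕ}
    (hanc : ∀ w ∈ C, D.Anc (D.first w) q) (hu : IsBoundary E C u) (hq : D.first u ≤ q) :
    u ∈ D.bag q := by
  obtain ⟨-, w, hw, e, he, hwe, hue⟩ := hu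
  obtain ⟨i, hi⟩ := hD.edge e he
  exact Anc.mem ((anc_first (hi w hwe)).trans (hanc w hw)) (hi u hue) (mem_first (hi u hue)) hq

/-- A component of the complement of a bag in `BB` such that all its neighbours occur in `D` earlier
than the component itself. These are the components that `D` decomposes. -/
structure IsBlock (D : BagSequence) (E : List (List ℕ)) (BB : List Bag) (C : List ℕ) : Prop where
  exists_eq : ∃ B ∈ BB, ∃ v ∈ verts E, v ∉ B.1 ∧ C = component E B.1 v
  first_lt : ∀ u, IsBoundary E C u → ∀ w ∈ C, D.first u < D.first w

/-- The first bag that meets a block is an ancestor of all the bags where vertices of the block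
occur first, so it contains the boundary of the block. -/
theorem IsBlock.exists_boundary_subset (hD : D.Decomposes E BB) {C : List ℕ}
    (hC : D.IsBlock E BB C) : ∃ w₀ ∈ C, (∀ w ∈ C, D.first w₀ ≤ D.first w) ∧
      ∀ u, IsBoundary E C u → u ∈ D.bag (D.first w₀) := by
  obtain ⟨⟨B₀, -, v₀, hv₀, -, rfl⟩, hlt⟩ := hC
  obtain ⟨w₀, hw₀, hmin⟩ := (component E B₀.1 v₀).toFinset.exists_min_image D.first
    ⟨v₀, by simpa using self_mem_component hv₀⟩
  simp only [List.mem_toFinset] at hw₀ hmin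
  exact ⟨w₀, hw₀, hmin, fun u hu => hD.mem_bag_of_isBoundary
    (fun w hw => hD.anc_of_mem_component hv₀ hw₀ hmin hw) hu (hlt u hu w₀ hw₀).le⟩

theorem isBlock_component (hD : D.Decomposes E BB) {B : Bag} {C : List ℕ} {q v : ℕ} (hB : B ∈ BB)
    (hBmem : ∀ x, x ∈ B.1 ↔ x ∈ D.bag q ∧ (x ∈ C ∨ IsBoundary E C x))
    (hboundary : ∀ u, IsBoundary E C u → u ∈ B.1) (hq : ∀ w ∈ C, q ≤ D.first w) (hv : v ∈ C)
    (hvE : v ∈ verts E) (hvB : v ∉ B.1) : D.IsBlock E BB (component E B.1 v) where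
  exists_eq := ⟨B, hB, v, hvE, hvB, rfl⟩
  first_lt u hu w hw := by
    have huq : D.first u ≤ q := first_le ((hBmem u).1 hu.mem).1
    have hwC : w ∈ C := (reach_of_boundary_subset (U := []) (by simp) hboundary hv
      (reach_of_mem_component hw)).1
    refine huq.trans_lt ((hq w hwC).lt_of_ne fun heq => notMem_of_mem_component hvB hw ?_)
    exact (hBmem w).2 ⟨heq ▸ hD.mem_bag_first (component_subset hw), .inl hwC⟩

theorem IsBlock.exists_isGoodBag (hD : D.Decomposes E BB) {C : List ℕ} (hC : D.IsBlock E BB C)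
    {T : List (List ℕ)} (hT : ∀ C, D.IsBlock E BB C → C ∈ T) :
    ∃ B ∈ BB, IsGoodBag E T C B.1 := by
  have hCE : ∀ v ∈ C, v ∈ verts E := by
    obtain ⟨⟨B₀, -, v₀, -, -, rfl⟩, -⟩ := hC
    exact fun v => component_subset
  obtain ⟨w₀, hw₀, hmin, hboundary⟩ := hC.exists_boundary_subset hD
  obtain ⟨B, hB, hBmem⟩ := hD.subset (D.first w₀)
    {u | u ∈ D.bag (D.first w₀) ∧ (u ∈ C ∨ IsBoundary E C u)} fun u hu => hu.1
  have hboundaryB : ∀ u, IsBoundary E C u → u ∈ B.1 := fun u hu =>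
    (hBmem u).2 ⟨hboundary u hu, .inr hu⟩
  exact ⟨B, hB, {
    boundary_subset := hboundaryB
    subset_closure := fun u hu => ((hBmem u).1 hu).2
    exists_mem := ⟨w₀, hw₀, (hBmem w₀).2 ⟨hD.mem_bag_first (hCE w₀ hw₀), .inl hw₀⟩⟩
    component_mem := fun v hv hvB =>
      hT _ (isBlock_component hD hB hBmem hboundaryB hmin hv (hCE v hv) hvB) }⟩

theorem IsBlock.mem_solvable (hD : D.Decomposes E BB) {C : List ℕ} (hC : D.IsBlock E BB C) :
    C ∈ solvable E BB := by
  refine Function.Iterate.rec (fun T => ∀ C, D.IsBlock E BB C → C ∈ T) (fun C hC => ?_)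
    (fun T hT C hC => ?_) _ C hC
  · obtain ⟨⟨B, hB, v, hv, hvB, rfl⟩, -⟩ := hC
    simp only [allComponents, List.mem_flatMap, List.mem_map, List.mem_filter]
    exact ⟨B, hB, v, ⟨hv, by simpa using hvB⟩, rfl⟩
  · obtain ⟨B, hB, hgood⟩ := hC.exists_isGoodBag hD hT
    exact List.mem_filter.2 ⟨hT C hC, List.any_eq_true.2 ⟨B, hB, goodBag_iff.2 hgood⟩⟩

theorem Decomposes.isComplete_decomposition (hD : D.Decomposes E BB) :
    isComplete E BB (decomposition E BB) = true := by
  obtain ⟨B, hB, hBmem⟩ := hD.subset 0 ∅ (Set.empty_subset _)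
  have hB_nil : B.1 = [] := List.eq_nil_iff_forall_not_mem.2 fun x hx => (hBmem x).1 hx
  refine isComplete_iff.2 ⟨List.ne_nil_of_mem hB, fun v hv => covered_decomposition
    (fun v hv => IsBlock.mem_solvable hD
      ⟨⟨B, hB, v, hv, by simp [hB_nil], by rw [hB_nil]⟩, fun u hu => ?_⟩) hv⟩
  simpa using hu.mem

end BagSequence

end

/-! ### Tree decompositions -/

section

variable {ι V : Type*} {T : SimpleGraph ι} {χ : ι → Set V}

/-- The labels of a tree have the connectedness property, expressed by paths: the vertices whose
labels contain a given node are closed under paths. -/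
def PathConvex (T : SimpleGraph ι) (χ : ι → Set V) : Prop :=
  ∀ (i j : ι) (p : T.Walk i j), p.IsPath → ∀ x, x ∈ χ i → x ∈ χ j → ∀ k ∈ p.support, x ∈ χ k

theorem pathConvex_of_preconnected (hT : T.IsAcyclic)
    (h : ∀ x, (T.induce {i | x ∈ χ i}).Preconnected) : PathConvex T χ := by
  intro i j p hp x hi hj k hk
  let inclusion := (SimpleGraph.Embedding.induce (G := T) {i | x ∈ χ i}).toHom
  obtain ⟨q, hq⟩ := (h x ⟨i, hi⟩ ⟨j, hj⟩).exists_isPath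
  have hq' : (q.map inclusion).IsPath :=
    SimpleGraph.Walk.IsPath.map (SimpleGraph.Embedding.induce (G := T) _).injective hq
  obtain rfl : p = q.map inclusion :=
    congrArg Subtype.val ((hT.subsingleton_path i j).elim ⟨p, hp⟩ ⟨_, hq'⟩)
  obtain ⟨⟨k', hk'⟩, -, rfl⟩ :=
    List.mem_map.1 (Eq.mp (congrArg (k ∈ ·) (SimpleGraph.Walk.support_map inclusion q)) hk)
  exact hk'

theorem PathConvex.induce (h : PathConvex T χ) (s : Set ι) :
    PathConvex (T.induce s) fun i => χ i.1 := by
  intro i j p hp x hi hj k hk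
  let inclusion := (SimpleGraph.Embedding.induce (G := T) s).toHom
  exact h i.1 j.1 (p.map inclusion)
    (SimpleGraph.Walk.IsPath.map (SimpleGraph.Embedding.induce (G := T) _).injective hp) x hi hj k.1
    (Eq.mpr (congrArg (k.1 ∈ ·) (SimpleGraph.Walk.support_map inclusion p))
      (List.mem_map.2 ⟨k, hk, rfl⟩))

theorem PathConvex.mem_of_forall_adj (h : PathConvex T χ) (hT : T.Connected) {l m i : ι}
    (hm : ∀ j, T.Adj l j → j = m) (hil : i ≠ l) {x : V} (hl : x ∈ χ l) (hi : x ∈ χ i) :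
    x ∈ χ m := by
  obtain ⟨p, hp⟩ := hT.exists_isPath l i
  have hadj := p.adj_snd (SimpleGraph.Walk.not_nil_of_ne hil.symm)
  exact h l i p hp x hl hi m (hm _ hadj ▸ p.getVert_mem_support 1)

end

/-- A finite sequence of bags, extended by empty ones, is continued by the bag `S`, with parent
`k₀`. -/
@[simps]
noncomputable def BagSequence.snoc (D : BagSequence) (n k₀ : ℕ) (S : Set ℕ) (hk₀ : k₀ ≤ n)
    (hempty : ∀ k > n, D.bag k = ∅) (hS : ∀ x ∈ S, ∀ k ≤ n, x ∈ D.bag k → x ∈ D.bag k₀) :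
    BagSequence where
  bag := Function.update D.bag (n + 1) S
  par := Function.update D.par (n + 1) k₀
  par_lt i hi := by
    rcases eq_or_ne i (n + 1) with rfl | hin
    · simpa [Nat.lt_succ_iff] using hk₀
    · simpa [hin] using D.par_lt i hi
  mem_par i hi x hx j hj hxj := by
    rcases lt_trichotomy i (n + 1) with hin | rfl | hin
    · have hpar := D.par_lt i hi
      simp only [Function.update_of_ne hin.ne] at hx ⊢
      rw [Function.update_of_ne (by omega)] at hxj ⊢
      exact D.mem_par i hi x hx j hj hxj
    · simp only [Function.update_self] at hx ⊢
      rw [Function.update_of_ne (by omega)] at hxj ⊢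
      exact hS x hx j (by omega) hxj
    · simp [hin.ne', hempty i (by omega)] at hx

/-- Removing a leaf of the tree leaves a smaller tree decomposition, and the bag of the leaf may be
put at the end. -/
theorem exists_bagSequence (n : ℕ) {ι : Type*} [Finite ι] (hn : Nat.card ι = n + 1)
    {T : SimpleGraph ι} (hT : T.IsTree) {χ : ι → Set ℕ} (h : PathConvex T χ) :
    ∃ D : BagSequence, (∀ k ≤ n, ∃ i, D.bag k = χ i) ∧ (∀ k > n, D.bag k = ∅) ∧
      ∀ i, ∃ k ≤ n, D.bag k = χ i := by
  classical
  induction n generalizing ι with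
  | zero =>
    obtain ⟨hsub, ⟨i₀⟩⟩ := Nat.card_eq_one_iff_unique.1 hn
    let D : BagSequence :=
      ⟨Function.update (fun _ => ∅) 0 (χ i₀), fun _ => 0, fun i hi => hi, fun i hi x hx => by
        simp [hi.ne'] at hx⟩
    exact ⟨D, fun k hk => ⟨i₀, by simp [D, Nat.le_zero.1 hk]⟩, fun k hk => by simp [D, hk.ne'],
      fun i => ⟨0, le_rfl, by simp [D, Subsingleton.elim i i₀]⟩⟩
  | succ n ih =>
    have := Fintype.ofFinite ι
    have : Nontrivial ι := by rw [← Finite.one_lt_card_iff_nontrivial]; omega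
    obtain ⟨l, hl⟩ := hT.exists_vert_degree_one_of_nontrivial
    obtain ⟨m, hlm, hm⟩ := SimpleGraph.degree_eq_one_iff_existsUnique_adj.1 hl
    have hT' : (T.induce {l}ᶜ).IsTree :=
      ⟨hT.connected.induce_compl_singleton_of_degree_eq_one hl, hT.isAcyclic.induce _⟩
    have hcard : Nat.card ({l}ᶜ : Set ι) = n + 1 := by
      have hadd := Set.ncard_add_ncard_compl ({l} : Set ι)
      rw [Set.ncard_singleton] at hadd
      rw [Nat.card_coe_set_eq]
      omega
    obtain ⟨D, hbag, hempty, hχ⟩ := ih hcard hT' (h.induce _)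
    obtain ⟨k₀, hk₀, hbag₀⟩ := hχ ⟨m, hlm.ne'⟩
    have hleaf : ∀ x ∈ χ l, ∀ k ≤ n, x ∈ D.bag k → x ∈ D.bag k₀ := by
      intro x hx k hk hxk
      obtain ⟨i, hi⟩ := hbag k hk
      exact hbag₀ ▸ h.mem_of_forall_adj hT.connected hm i.2 hx (hi ▸ hxk)
    refine ⟨D.snoc n k₀ (χ l) hk₀ hempty hleaf, fun k hk => ?_, fun k hk => ?_, fun i => ?_⟩
    · rcases hk.eq_or_lt with rfl | hk
      · exact ⟨l, by simp⟩
      · obtain ⟨i, hi⟩ := hbag k (by omega)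
        exact ⟨i, by simp [hk.ne, hi]⟩
    · simp [hk.ne', hempty k (by omega)]
    · rcases eq_or_ne i l with rfl | hi
      · exact ⟨n + 1, le_rfl, by simp⟩
      · obtain ⟨k, hk, heq⟩ := hχ ⟨i, hi⟩
        exact ⟨k, by omega, by simp [show k ≠ n + 1 by omega, heq]⟩

/-! ### Trees from parent functions -/

theorem edgeSet_subset_image_of_parent {ι : Type*} {G : SimpleGraph ι} {parent : ι → ι} {r : ι}
    (hr : parent r = r) (hG : ∀ p q, G.Adj p q → q = parent p ∨ p = parent q) :
    G.edgeSet ⊆ (fun p => s(p, parent p)) '' {r}ᶜ := by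
  have hne_root : ∀ p, p ≠ parent p → p ∈ ({r}ᶜ : Set ι) := by
    rintro p hne rfl
    exact hne hr.symm
  intro e he
  induction e using Sym2.ind with
  | _ p q =>
    rcases hG p q he with rfl | rfl
    · exact ⟨p, hne_root p he.ne, rfl⟩
    · exact ⟨q, hne_root q he.ne', Sym2.eq_swap⟩

section

variable {N : ℕ} {par : ℕ → ℕ}

/-- The graph on the numbers below `N` that joins every number to its parent. -/
def parentGraph (N : ℕ) (par : ℕ → ℕ) : SimpleGraph (Fin N) :=
  SimpleGraph.fromRel fun p q => q.1 = par p.1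

theorem parentGraph_adj (hpar : ∀ i, 0 < i → i < N → par i < i) {i : ℕ} (hpos : 0 < i)
    (hi : i < N) : (parentGraph N par).Adj ⟨i, hi⟩ ⟨par i, (hpar i hpos hi).trans hi⟩ := by
  refine (SimpleGraph.fromRel_adj _ _ _).2 ⟨fun heq => ?_, .inl rfl⟩
  exact (hpar i hpos hi).ne' (congrArg Fin.val heq)

theorem connected_parentGraph (hN : 0 < N) (hpar : ∀ i, 0 < i → i < N → par i < i) :
    (parentGraph N par).Connected := by
  have hroot : ∀ i, ∀ hi : i < N, (parentGraph N par).Reachable ⟨i, hi⟩ ⟨0, hN⟩ := by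
    intro i
    induction i using Nat.strong_induction_on with
    | _ i ih =>
      intro hi
      rcases Nat.eq_zero_or_pos i with rfl | hpos
      · exact .refl _
      · exact (parentGraph_adj hpar hpos hi).reachable.trans (ih _ (hpar i hpos hi) _)
  have : Nonempty (Fin N) := ⟨⟨0, hN⟩⟩
  exact ⟨fun i j => (hroot i.1 i.2).trans (hroot j.1 j.2).symm⟩

theorem isTree_parentGraph (hN : 0 < N) (hpar : ∀ i, 0 < i → i < N → par i < i)
    (hzero : par 0 = 0) : (parentGraph N par).IsTree := by
  have hconn := connected_parentGraph hN hpar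
  refine SimpleGraph.isTree_iff_connected_and_card.2 ⟨hconn, ?_⟩
  have hpar_lt (i : Fin N) : par i.1 < N := by
    rcases Nat.eq_zero_or_pos i.1 with h | h
    · rwa [h, hzero]
    · exact (hpar i.1 h i.2).trans i.2
  have hsub := edgeSet_subset_image_of_parent (G := parentGraph N par)
    (parent := fun i => ⟨par i.1, hpar_lt i⟩) (r := ⟨0, hN⟩) (Fin.ext hzero) fun p q hadj =>
      ((SimpleGraph.fromRel_adj _ _ _).1 hadj).2.imp Fin.ext Fin.ext
  have hle := (Set.ncard_le_ncard hsub (Set.toFinite _)).trans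
    (Set.ncard_image_le (Set.toFinite _))
  have hcompl := Set.ncard_add_ncard_compl ({⟨0, hN⟩} : Set (Fin N))
  have hge := hconn.card_vert_le_card_edgeSet_add_one
  rw [Set.ncard_singleton] at hcompl
  rw [← Nat.card_coe_set_eq] at hle
  omega

theorem preconnected_induce_parentGraph (hpar : ∀ i, 0 < i → i < N → par i < i) {s : Set ℕ}
    (hs : ∀ i, 0 < i → i < N → i ∈ s → ∀ j < i, j ∈ s → par i ∈ s) :
    ((parentGraph N par).induce {p | p.1 ∈ s}).Preconnected := by
  classical
  rintro ⟨p, hp⟩ ⟨q, hq⟩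
  have hex : ∃ i, i < N ∧ i ∈ s := ⟨p.1, p.2, hp⟩
  obtain ⟨hmN, hms⟩ := Nat.find_spec hex
  have hmin : ∀ j < Nat.find hex, j ∉ s := fun j hj hjs => Nat.find_min hex hj ⟨hj.trans hmN, hjs⟩
  have hreach : ∀ i, ∀ hi : i < N, ∀ his : i ∈ s,
      ((parentGraph N par).induce {p : Fin N | p.1 ∈ s}).Reachable ⟨⟨i, hi⟩, his⟩
        ⟨⟨Nat.find hex, hmN⟩, hms⟩ := by
    intro i
    induction i using Nat.strong_induction_on with
    | _ i ih =>
      intro hi his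
      rcases lt_trichotomy i (Nat.find hex) with hlt | rfl | hgt
      · exact absurd his (hmin i hlt)
      · exact .refl _
      · have hpos : 0 < i := by omega
        refine .trans (SimpleGraph.Adj.reachable ?_)
          (ih _ (hpar i hpos hi) ((hpar i hpos hi).trans hi) (hs i hpos hi his _ hgt hms))
        exact parentGraph_adj hpar hpos hi
  exact (hreach p.1 p.2 hp).trans (hreach q.1 q.2 hq).symm

end

/-! ### Numbering the bags -/

/-- A numbered bag `(i, p, B)`: its number, the number of its parent, and the bag itself. -/
abbrev NumberedBag : Type := ℕ × ℕ × List ℕ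

/-- The number of the bag that is added to `R` next: `R` lists the numbered bags from the last to
the first. -/
def nextNumber (R : List NumberedBag) : ℕ :=
  match R with
  | [] => 0
  | e :: _ => e.1 + 1

/-- The possible parents of the bag `B`: the bags in `R` that contain everything that `B` shares
with `R`. -/
def parents (B : List ℕ) (R : List NumberedBag) : List NumberedBag :=
  R.filter fun e => B.all fun x =>
    !decide (x ∈ (R.map fun e' => e'.2.2).flatten) || decide (x ∈ e.2.2)

/-- The number of a parent of the bag `B`, or `0` if no bag in `R` can be its parent. -/
def parent (B : List ℕ) (R : List NumberedBag) : ℕ :=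
  match parents B R with
  | [] => 0
  | e :: _ => e.1

/-- Number the bags of a decomposition, starting from the end of the list. -/
def number (L : List Bag) : List NumberedBag :=
  L.foldr (fun B R => (nextNumber R, parent B.1 R, B.1) :: R) []

/-- The bag with the number `i`, where the last bag of the list has the number `0`. -/
def bagAt (L : List Bag) (i : ℕ) : List ℕ := (L.reverse.getD i ([], [])).1

theorem nextNumber_number (L : List Bag) : nextNumber (number L) = L.length := by
  induction L with
  | nil => rfl
  | cons B L ih => exact congrArg (· + 1) ih

theorem number_cons (B : Bag) (L : List Bag) :
    number (B :: L) = (L.length, parent B.1 (number L), B.1) :: number L := by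
  rw [← nextNumber_number L]
  rfl

theorem mem_parents {B : List ℕ} {R : List NumberedBag} {e : NumberedBag} :
    e ∈ parents B R ↔ e ∈ R ∧ ∀ x ∈ B, (∃ e' ∈ R, x ∈ e'.2.2) → x ∈ e.2.2 := by
  simp only [parents, List.mem_filter, List.all_eq_true, Bool.or_eq_true, Bool.not_eq_true',
    decide_eq_false_iff_not, decide_eq_true_eq, List.mem_flatten, List.mem_map,
    ← imp_iff_not_or, exists_exists_and_eq_and]

theorem exists_parent_eq {B : List ℕ} {R : List NumberedBag} (h : parents B R ≠ []) :
    ∃ e ∈ parents B R, parent B R = e.1 := by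
  unfold parent
  cases hparents : parents B R with
  | nil => exact absurd hparents h
  | cons e l => exact ⟨e, by simp, rfl⟩

theorem bagAt_cons_of_lt {B : Bag} {L : List Bag} {i : ℕ} (h : i < L.length) :
    bagAt (B :: L) i = bagAt L i := by
  rw [bagAt, bagAt, List.reverse_cons, List.getD_append _ _ _ _ (by simpa using h)]

theorem bagAt_cons_length (B : Bag) (L : List Bag) : bagAt (B :: L) L.length = B.1 := by
  rw [bagAt, List.reverse_cons, List.getD_append_right _ _ _ _ (by simp)]
  simp

theorem exists_mem_bagAt_eq {L : List Bag} {i : ℕ} (h : i < L.length) :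
    ∃ B ∈ L, bagAt L i = B.1 := by
  have hi : i < L.reverse.length := by simpa using h
  exact ⟨L.reverse[i], List.mem_reverse.1 (List.getElem_mem _), by
    rw [bagAt, List.getD_eq_getElem _ _ hi]⟩

theorem exists_bagAt_eq_of_mem {L : List Bag} {B : Bag} (h : B ∈ L) :
    ∃ i < L.length, bagAt L i = B.1 := by
  obtain ⟨i, hi, rfl⟩ := List.mem_iff_getElem.1 (List.mem_reverse.2 h)
  exact ⟨i, by simpa using hi, by rw [bagAt, List.getD_eq_getElem _ _ hi]⟩

theorem mem_covered {L : List Bag} {x : ℕ} : x ∈ covered L ↔ ∃ i < L.length, x ∈ bagAt L i := by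
  rw [covered, List.mem_flatten]
  constructor
  · rintro ⟨_, hmem, hx⟩
    obtain ⟨B, hB, rfl⟩ := List.mem_map.1 hmem
    obtain ⟨i, hi, heq⟩ := exists_bagAt_eq_of_mem hB
    exact ⟨i, hi, heq ▸ hx⟩
  · rintro ⟨i, hi, hx⟩
    obtain ⟨B, hB, heq⟩ := exists_mem_bagAt_eq hi
    exact ⟨_, List.mem_map.2 ⟨B, hB, rfl⟩, heq ▸ hx⟩

/-- The parents recorded by `number L` are given by `par` and turn the bags of `L` into a tree with
the connectedness property; no bag repeats only vertices of earlier ones. -/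
structure IsNumbering (L : List Bag) (par : ℕ → ℕ) : Prop where
  pos : 0 < L.length
  number_eq : number L = ((List.range L.length).map fun i => (i, par i, bagAt L i)).reverse
  par_zero : par 0 = 0
  par_lt : ∀ i, 0 < i → i < L.length → par i < i
  mem_par : ∀ i, 0 < i → i < L.length → ∀ x ∈ bagAt L i, ∀ j < i, x ∈ bagAt L j →
    x ∈ bagAt L (par i)
  exists_new : ∀ i, 0 < i → i < L.length → ∃ x ∈ bagAt L i, ∀ j < i, x ∉ bagAt L j

section

variable {L : List Bag} {par : ℕ → ℕ}

theorem isNumbering_singleton : IsNumbering [([], [])] fun _ => 0 where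
  pos := by simp
  number_eq := by simp [number, nextNumber, parent, parents, bagAt]
  par_zero := rfl
  par_lt i hpos _ := hpos
  mem_par i hpos hi := absurd hi (by simpa using hpos.ne')
  exists_new i hpos hi := absurd hi (by simpa using hpos.ne')

theorem IsNumbering.mem_number (h : IsNumbering L par) {e : NumberedBag} :
    e ∈ number L ↔ ∃ i < L.length, (i, par i, bagAt L i) = e := by
  simp [h.number_eq]

theorem IsNumbering.parent_mem (h : IsNumbering L par) {B : Bag}
    (hB : ∃ B' ∈ L, ∀ x ∈ B.1, x ∈ covered L → x ∈ B'.1) :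
    parent B.1 (number L) < L.length ∧
      ∀ x ∈ B.1, x ∈ covered L → x ∈ bagAt L (parent B.1 (number L)) := by
  have hcovered (x : ℕ) : (∃ e ∈ number L, x ∈ e.2.2) ↔ x ∈ covered L := by
    simp [mem_covered, h.mem_number]
  obtain ⟨B', hB', hBB'⟩ := hB
  obtain ⟨i, hi, hi_eq⟩ := exists_bagAt_eq_of_mem hB'
  have hmem : (i, par i, bagAt L i) ∈ parents B.1 (number L) :=
    mem_parents.2 ⟨h.mem_number.2 ⟨i, hi, rfl⟩, fun x hx hxL => by
      rw [hi_eq]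
      exact hBB' x hx ((hcovered x).1 hxL)⟩
  obtain ⟨e, he, heq⟩ := exists_parent_eq (List.ne_nil_of_mem hmem)
  obtain ⟨he, hshared⟩ := mem_parents.1 he
  obtain ⟨j, hj, rfl⟩ := h.mem_number.1 he
  rw [heq]
  exact ⟨hj, fun x hx hxL => hshared x hx ((hcovered x).2 hxL)⟩

theorem IsNumbering.number_cons_eq (h : IsNumbering L par) (B : Bag) :
    number (B :: L) = ((List.range (B :: L).length).map fun i =>
      (i, Function.update par L.length (parent B.1 (number L)) i, bagAt (B :: L) i)).reverse := by
  rw [number_cons, List.length_cons, List.range_succ, List.map_append, List.reverse_append]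
  simp only [List.map_cons, List.map_nil, List.reverse_singleton, Function.update_self,
    bagAt_cons_length, List.singleton_append]
  conv_lhs => arg 2; rw [h.number_eq]
  refine congrArg (List.cons _) (congrArg List.reverse (List.map_congr_left fun i hi => ?_))
  have hi := List.mem_range.1 hi
  rw [bagAt_cons_of_lt hi, Function.update_of_ne hi.ne]

theorem IsNumbering.cons (h : IsNumbering L par) {B : Bag}
    (hB : ∃ B' ∈ L, ∀ x ∈ B.1, x ∈ covered L → x ∈ B'.1) (hnew : ∃ x ∈ B.1, x ∉ covered L) :
    IsNumbering (B :: L) (Function.update par L.length (parent B.1 (number L))) := by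
  obtain ⟨hparent_lt, hparent_mem⟩ := h.parent_mem hB
  constructor
  case pos => simp
  case number_eq => exact h.number_cons_eq B
  case par_zero => rw [Function.update_of_ne h.pos.ne, h.par_zero]
  case par_lt =>
    intro i hpos hi
    rcases (Nat.lt_succ_iff_lt_or_eq.1 hi) with hi | rfl
    · rw [Function.update_of_ne hi.ne]
      exact h.par_lt i hpos hi
    · rwa [Function.update_self]
  case mem_par =>
    intro i hpos hi x hx j hj hxj
    rcases (Nat.lt_succ_iff_lt_or_eq.1 hi) with hi | rfl
    · have hlt := h.par_lt i hpos hi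
      rw [Function.update_of_ne hi.ne, bagAt_cons_of_lt (by omega)]
      rw [bagAt_cons_of_lt (by omega)] at hx hxj
      exact h.mem_par i hpos hi x hx j hj hxj
    · rw [Function.update_self, bagAt_cons_of_lt hparent_lt]
      rw [bagAt_cons_length] at hx
      rw [bagAt_cons_of_lt hj] at hxj
      exact hparent_mem x hx (mem_covered.2 ⟨j, hj, hxj⟩)
  case exists_new =>
    intro i hpos hi
    rcases (Nat.lt_succ_iff_lt_or_eq.1 hi) with hi | rfl
    · obtain ⟨x, hx, hx_new⟩ := h.exists_new i hpos hi
      refine ⟨x, by rwa [bagAt_cons_of_lt hi], fun j hj => ?_⟩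
      rw [bagAt_cons_of_lt (hj.trans hi)]
      exact hx_new j hj
    · obtain ⟨x, hx, hx_new⟩ := hnew
      refine ⟨x, by rwa [bagAt_cons_length], fun j hj hxj => hx_new (mem_covered.2 ⟨j, hj, ?_⟩)⟩
      rwa [bagAt_cons_of_lt hj] at hxj

theorem RunningIntersection.exists_isNumbering (h : RunningIntersection L) :
    ∃ par, IsNumbering L par := by
  induction h with
  | base => exact ⟨_, isNumbering_singleton⟩
  | step _ hB hnew ih =>
    obtain ⟨par, hpar⟩ := ih
    exact ⟨_, hpar.cons hB hnew⟩

theorem IsNumbering.isTree (h : IsNumbering L par) : (parentGraph L.length par).IsTree :=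
  isTree_parentGraph h.pos h.par_lt h.par_zero

theorem IsNumbering.preconnected (h : IsNumbering L par) (x : ℕ) :
    ((parentGraph L.length par).induce {p | x ∈ bagAt L p.1}).Preconnected :=
  preconnected_induce_parentGraph (s := {i | x ∈ bagAt L i}) h.par_lt
    fun i hpos hi hx j hj hxj => h.mem_par i hpos hi x hx j hj hxj

theorem IsNumbering.injective (h : IsNumbering L par) :
    Function.Injective fun p : Fin L.length => {x | x ∈ bagAt L p.1} := by
  have hne : ∀ p q : Fin L.length, p < q → {x | x ∈ bagAt L p.1} ≠ {x | x ∈ bagAt L q.1} := by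
    intro p q hpq heq
    obtain ⟨x, hx, hx_new⟩ := h.exists_new q.1 (Nat.zero_lt_of_lt hpq) q.2
    exact hx_new p.1 hpq ((Set.ext_iff.1 heq x).2 hx)
  intro p q heq
  by_contra hpq
  rcases lt_or_gt_of_ne hpq with hlt | hlt
  exacts [hne p q hlt heq, hne q p hlt heq.symm]

theorem isAcyclicHypergraph_of_pathConvex {ι : Type*} {T : SimpleGraph ι} (hT : T.IsTree)
    {H : Hypergraph ℕ} (e : ι ≃ H.edgeSet) (h : PathConvex T fun i => (e i).1) :
    IsAcyclicHypergraph H := by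
  let I := SimpleGraph.Iso.map e T
  refine ⟨_, I.isTree_iff.1 hT, fun h₁ h₂ p hp X hX₁ hX₂ h₃ hh₃ => ?_⟩
  have hval (h' : H.edgeSet) : (e (I.symm h')).1 = h'.1 :=
    congrArg Subtype.val (e.apply_symm_apply h')
  rw [← hval h₁] at hX₁
  rw [← hval h₂] at hX₂
  rw [← hval h₃]
  refine h _ _ _ (SimpleGraph.Walk.IsPath.map (f := I.symm.toHom) I.symm.injective hp) X hX₁ hX₂
    (I.symm h₃) ?_
  rw [SimpleGraph.Walk.support_map]
  exact List.mem_map.2 ⟨h₃, hh₃, rfl⟩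

theorem RunningIntersection.isAcyclicHypergraph (h : RunningIntersection L) {H : Hypergraph ℕ}
    (hH : H.edgeSet = {e | ∃ B ∈ L, e = {x | x ∈ B.1}}) : IsAcyclicHypergraph H := by
  obtain ⟨par, hpar⟩ := h.exists_isNumbering
  have hmem (p : Fin L.length) : {x | x ∈ bagAt L p.1} ∈ H.edgeSet := by
    obtain ⟨B, hB, heq⟩ := exists_mem_bagAt_eq p.2
    rw [hH]
    exact ⟨B, hB, by rw [heq]⟩
  let f : Fin L.length → H.edgeSet := fun p => ⟨_, hmem p⟩
  have hf_inj : Function.Injective f := fun p q hpq => hpar.injective (congrArg Subtype.val hpq)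
  have hf_surj : Function.Surjective f := by
    rintro ⟨e, he⟩
    obtain ⟨B, hB, rfl⟩ := hH ▸ he
    obtain ⟨i, hi, heq⟩ := exists_bagAt_eq_of_mem hB
    exact ⟨⟨i, hi⟩, Subtype.ext (by simp only [f, heq])⟩
  exact isAcyclicHypergraph_of_pathConvex hpar.isTree (.ofBijective f ⟨hf_inj, hf_surj⟩)
    (pathConvex_of_preconnected hpar.isTree.isAcyclic hpar.preconnected)

end

/-! ### Numbering in polynomial time -/

theorem encSize_nat_le (n : ℕ) : encSize n ≤ 4 * n + 1 := by
  have hbits (n : ℕ) : encSize n = encSize n.bits := rfl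
  induction n with
  | zero => simp [hbits]
  | succ n ih =>
    have hinc := encSize_incBits_le n.bits
    rw [hbits, bits_succ]
    rw [hbits] at ih
    omega

theorem length_number (L : List Bag) : (number L).length = L.length := by
  induction L with
  | nil => rfl
  | cons B L ih => simp [number_cons, ih]

theorem parent_le {B : List ℕ} {R : List NumberedBag} {n : ℕ} (h : ∀ e ∈ R, e.1 ≤ n) :
    parent B R ≤ n := by
  by_cases hparents : parents B R = []
  · simp [parent, hparents]
  · obtain ⟨e, he, heq⟩ := exists_parent_eq hparents
    exact heq ▸ h e (mem_parents.1 he).1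

theorem bounds_of_mem_number {L : List Bag} {e : NumberedBag} (he : e ∈ number L) :
    e.1 ≤ L.length ∧ e.2.1 ≤ L.length ∧ ∃ B ∈ L, e.2.2 = B.1 := by
  induction L generalizing e with
  | nil => simp [number] at he
  | cons B L ih =>
    rw [List.length_cons]
    rw [number_cons] at he
    rcases List.mem_cons.1 he with rfl | he
    · exact ⟨Nat.le_succ _, (parent_le fun _ he' => (ih he').1).trans (Nat.le_succ _), B,
        by simp, rfl⟩
    · obtain ⟨hnumber, hparent, B', hB', heq⟩ := ih he
      exact ⟨hnumber.trans (Nat.le_succ _), hparent.trans (Nat.le_succ _), B', by simp [hB'], heq⟩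

theorem encSize_number_le (L : List Bag) :
    encSize (number L) ≤ encSize L * (9 * encSize L + 5) + 1 := by
  have hlen := length_lt_encSize L
  refine (encSize_list_le (M := 9 * encSize L + 4) fun e he => ?_).trans ?_
  · obtain ⟨hnumber, hparent, B, hB, heq⟩ := bounds_of_mem_number he
    have hB_le := encSize_lt_of_mem hB
    have hnumber_le := encSize_nat_le e.1
    have hparent_le := encSize_nat_le e.2.1
    obtain ⟨i, p, C⟩ := e
    obtain ⟨C', _⟩ := B
    obtain rfl : C = C' := heq
    rw [encSize_pair] at hB_le
    simp only [encSize_pair]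
    dsimp only at hnumber hparent hnumber_le hparent_le
    omega
  · rw [length_number]
    gcongr

namespace PolyTime

variable {α : Type} [TreeEncodable α]

theorem nextNumber {R : α → List NumberedBag} (hR : PolyTime R) :
    PolyTime fun a => nextNumber (R a) :=
  congr (list_cases (g := fun (_ : α) (e : NumberedBag) (_ : List NumberedBag) => e.1 + 1) hR
    (const 0) (succ.comp (fst (fst (snd id))))) fun a => by
      unfold TreeProj.nextNumber
      cases R a <;> rfl

theorem parents {B : α → List ℕ} {R : α → List NumberedBag} (hB : PolyTime B) (hR : PolyTime R) :
    PolyTime fun a => parents (B a) (R a) :=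
  filter hR (all hB.comp_fst (or
    (not (mem_nat (snd id) (flatten (map hR.comp_fst.comp_fst (snd (snd (snd id)))))))
    (mem_nat (snd id) (snd (snd (snd (fst id)))))))

theorem parent {B : α → List ℕ} {R : α → List NumberedBag} (hB : PolyTime B) (hR : PolyTime R) :
    PolyTime fun a => parent (B a) (R a) :=
  congr (list_cases (g := fun _ e _ => e.1) (parents hB hR) (const 0) (fst (fst (snd id))))
    fun a => by
      unfold TreeProj.parent
      cases TreeProj.parents (B a) (R a) <;> rfl

theorem number {L : α → List Bag} (hL : PolyTime L) : PolyTime fun a => number (L a) := by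
  obtain ⟨P, hP⟩ := hL.exists_encSize_le
  refine foldr hL (const [])
    (step := fun _ B R => (TreeProj.nextNumber R, TreeProj.parent B.1 R, B.1) :: R)
    (cons (pair (nextNumber (snd (snd id)))
      (pair (parent (fst (fst (snd id))) (snd (snd id))) (fst (fst (snd id))))) (snd (snd id)))
    (P * (9 * P + 5) + 1) fun a L' hL' => ?_
  have hle : encSize L' ≤ P.eval (encSize a) := (encSize_le_of_sublist hL'.sublist).trans (hP a)
  refine (encSize_number_le L').trans ?_
  simp only [eval_add, eval_mul, eval_ofNat, eval_one]
  gcongr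

end PolyTime

/-! ### Enumerating the subsets of the views -/

/-- A bag under construction, together with the vertices of its view that are still to be
processed. -/
abbrev PartialBag : Type := Bag × List ℕ

/-- Decide whether the next vertex of the view belongs to the bag. -/
def branchOnNext : PartialBag → List PartialBag
  | (B, []) => [(B, [])]
  | (B, x :: t) => [((x :: B.1, B.2), t), (B, t)]

/-- The empty bags from which the construction of the subsets of the views starts. -/
def initialBags (vs : List Bag) : List PartialBag :=
  vs.map fun v => (([], v.2), v.1)

/-- The partial bags after processing `n` vertices of each view. -/
def partialBags (vs : List Bag) (n : ℕ) : List PartialBag :=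
  (fun L : List PartialBag => L.flatMap branchOnNext)^[n] (initialBags vs)

/-- All bags that are subsets of views. A view is a bag as well: a list of vertices and a label. The
total length of the views serves as a bound on the number of vertices of each of them. -/
def subBags (vs : List Bag) : List Bag :=
  (partialBags vs (covered vs).length).map fun e => e.1

theorem partialBags_induction {p : PartialBag → Prop} {vs : List Bag}
    (hinit : ∀ v ∈ vs, p (([], v.2), v.1)) (hstep : ∀ e, p e → ∀ e' ∈ branchOnNext e, p e')
    (n : ℕ) : ∀ e ∈ partialBags vs n, p e := by
  refine Function.Iterate.rec (fun L : List PartialBag => ∀ e ∈ L, p e) (fun e he => ?_)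
    (fun L hL e he => ?_) n
  · obtain ⟨v, hv, rfl⟩ := List.mem_map.1 he
    exact hinit v hv
  · obtain ⟨e', he', he⟩ := List.mem_flatMap.1 he
    exact hstep e' (hL e' he') e he

theorem mem_branchOnNext_cons {B : Bag} {x : ℕ} {t : List ℕ} {e : PartialBag} :
    e ∈ branchOnNext (B, x :: t) ↔ e = ((x :: B.1, B.2), t) ∨ e = (B, t) := by
  simp [branchOnNext]

theorem exists_view_of_mem_subBags {vs : List Bag} {B : Bag} (h : B ∈ subBags vs) :
    ∃ v ∈ vs, B.2 = v.2 ∧ ∀ x ∈ B.1, x ∈ v.1 := by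
  obtain ⟨e, he, rfl⟩ := List.mem_map.1 h
  suffices hsub : ∃ v ∈ vs, e.1.2 = v.2 ∧ (∀ x ∈ e.1.1, x ∈ v.1) ∧ ∀ x ∈ e.2, x ∈ v.1 by
    obtain ⟨v, hv, hlabel, hbag, -⟩ := hsub
    exact ⟨v, hv, hlabel, hbag⟩
  refine partialBags_induction (p := fun e => ∃ v ∈ vs, e.1.2 = v.2 ∧ (∀ x ∈ e.1.1, x ∈ v.1) ∧
    ∀ x ∈ e.2, x ∈ v.1) (fun v hv => ⟨v, hv, rfl, by simp, fun x hx => hx⟩) ?_ _ e he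
  rintro ⟨B, _ | ⟨x, t⟩⟩ ⟨v, hv, hlabel, hbag, hrest⟩ e' he'
  · obtain rfl : e' = (B, []) := by simpa [branchOnNext] using he'
    exact ⟨v, hv, hlabel, hbag, hrest⟩
  · obtain ⟨hx, ht⟩ := List.forall_mem_cons.1 hrest
    rcases mem_branchOnNext_cons.1 he' with rfl | rfl
    · exact ⟨v, hv, hlabel, List.forall_mem_cons.2 ⟨hx, hbag⟩, ht⟩
    · exact ⟨v, hv, hlabel, hbag, ht⟩

theorem exists_mem_iterate_branchOnNext {S : Set ℕ} (n : ℕ) {L : List PartialBag} {e : PartialBag}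
    (he : e ∈ L) (hn : e.2.length ≤ n) (hbag : ∀ x ∈ e.1.1, x ∈ S)
    (hS : ∀ x ∈ S, x ∈ e.1.1 ∨ x ∈ e.2) :
    ∃ e' ∈ (fun L : List PartialBag => L.flatMap branchOnNext)^[n] L, e'.1.2 = e.1.2 ∧
      ∀ x, x ∈ e'.1.1 ↔ x ∈ S := by
  induction n generalizing L e with
  | zero =>
    have hrest : e.2 = [] := List.length_eq_zero_iff.1 (Nat.le_zero.1 hn)
    exact ⟨e, he, rfl, fun x => ⟨hbag x, fun hx => (hS x hx).resolve_right (by simp [hrest])⟩⟩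
  | succ n ih =>
    rw [Function.iterate_succ_apply]
    have hmem : ∀ e' ∈ branchOnNext e, e' ∈ L.flatMap branchOnNext := fun e' he' =>
      List.mem_flatMap.2 ⟨e, he, he'⟩
    obtain ⟨B, _ | ⟨x, t⟩⟩ := e
    · exact ih (e := (B, [])) (hmem _ (by simp [branchOnNext])) (Nat.zero_le n) hbag hS
    · have ht : t.length ≤ n := Nat.le_of_succ_le_succ hn
      by_cases hx : x ∈ S
      · refine ih (e := ((x :: B.1, B.2), t)) (hmem _ (mem_branchOnNext_cons.2 (.inl rfl))) ht
          (List.forall_mem_cons.2 ⟨hx, hbag⟩) fun y hy => ?_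
        have hy' := hS y hy
        simp only [List.mem_cons] at hy' ⊢
        tauto
      · refine ih (e := (B, t)) (hmem _ (mem_branchOnNext_cons.2 (.inr rfl))) ht hbag fun y hy => ?_
        exact (hS y hy).imp_right fun hyt =>
          (List.mem_cons.1 hyt).resolve_left (ne_of_mem_of_not_mem hy hx)

theorem exists_mem_subBags {vs : List Bag} {v : Bag} (hv : v ∈ vs) {S : Set ℕ}
    (hS : ∀ x ∈ S, x ∈ v.1) : ∃ B ∈ subBags vs, B.2 = v.2 ∧ ∀ x, x ∈ B.1 ↔ x ∈ S := by
  have hlen : v.1.length ≤ (covered vs).length :=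
    (List.sublist_flatten_of_mem (List.mem_map_of_mem hv)).length_le
  obtain ⟨e, he, hlabel, hbag⟩ := exists_mem_iterate_branchOnNext (covered vs).length
    (L := initialBags vs) (e := (([], v.2), v.1)) (List.mem_map_of_mem hv) hlen (by simp)
    fun x hx => .inr (hS x hx)
  exact ⟨e.1, List.mem_map_of_mem he, hlabel, hbag⟩

/-- The number of bags that arise from a list of partial bags. -/
def weight (L : List PartialBag) : ℕ := (L.map fun e => 2 ^ e.2.length).sum

theorem length_le_weight (L : List PartialBag) : L.length ≤ weight L := by
  have h := List.card_nsmul_le_sum (L.map fun e => 2 ^ e.2.length) 1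
    (List.forall_mem_map.2 fun e _ => Nat.one_le_two_pow)
  simpa [weight] using h

theorem weight_flatMap (L : List PartialBag) : weight (L.flatMap branchOnNext) = weight L := by
  have hbranch (e : PartialBag) :
      ((branchOnNext e).map fun e => 2 ^ e.2.length).sum = 2 ^ e.2.length := by
    obtain ⟨B, _ | ⟨x, t⟩⟩ := e
    · simp [branchOnNext]
    · simp [branchOnNext, pow_succ, mul_two]
  induction L with
  | nil => rfl
  | cons e L ih =>
    simp only [weight, List.flatMap_cons, List.map_append, List.sum_append, List.map_cons,
      List.sum_cons, hbranch] at ih ⊢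
    rw [ih]

theorem length_partialBags_le {vs : List Bag} {K : ℕ} (hK : ∀ v ∈ vs, v.1.length ≤ K) (n : ℕ) :
    (partialBags vs n).length ≤ vs.length * 2 ^ K := by
  have hweight : weight (partialBags vs n) = weight (initialBags vs) :=
    Function.Iterate.rec (fun L => weight L = weight (initialBags vs)) rfl
      (fun L hL => (weight_flatMap L).trans hL) n
  have hinit : weight (initialBags vs) ≤ vs.length * 2 ^ K := by
    have hsum := List.sum_le_card_nsmul ((initialBags vs).map fun e => 2 ^ e.2.length) (2 ^ K)
      (by
        simp only [initialBags, List.forall_mem_map]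
        exact fun v hv => Nat.pow_le_pow_right two_pos (hK v hv))
    simpa [weight, initialBags] using hsum
  exact (length_le_weight _).trans (hweight.trans_le hinit)

theorem encSize_partialBag_le {vs : List Bag} {n : ℕ} {e : PartialBag} (he : e ∈ partialBags vs n) :
    encSize e ≤ encSize vs + 2 := by
  refine partialBags_induction (p := fun e => encSize e ≤ encSize vs + 2) (fun v hv => ?_) ?_ n e he
  · obtain ⟨l, label⟩ := v
    have hlt := encSize_lt_of_mem hv
    simp only [encSize_pair, encSize_nil] at hlt ⊢
    omega
  · rintro ⟨B, _ | ⟨x, t⟩⟩ hle e' he'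
    · obtain rfl : e' = (B, []) := by simpa [branchOnNext] using he'
      exact hle
    · obtain ⟨l, label⟩ := B
      rcases mem_branchOnNext_cons.1 he' with rfl | rfl <;>
        simp only [encSize_pair, encSize_cons] at hle ⊢ <;> omega

theorem encSize_partialBags_le {vs : List Bag} {K : ℕ} (hK : ∀ v ∈ vs, v.1.length ≤ K) (n : ℕ) :
    encSize (partialBags vs n) ≤ (encSize vs * 2 ^ K) * (encSize vs + 3) + 1 := by
  refine (encSize_list_le fun e he => encSize_partialBag_le he).trans ?_
  have hlen := (length_partialBags_le hK n).trans
    (Nat.mul_le_mul_right (2 ^ K) (length_lt_encSize vs).le)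
  gcongr

namespace PolyTime

variable {α : Type} [TreeEncodable α]

theorem branchOnNext {e : α → PartialBag} (he : PolyTime e) :
    PolyTime fun a => branchOnNext (e a) :=
  congr (list_cases (g := fun a x t => [((x :: (e a).1.1, (e a).1.2), t), ((e a).1, t)]) (snd he)
    (cons he (const []))
    (cons (pair (pair (cons (fst (snd id)) (fst (fst he)).comp_fst) (snd (fst he)).comp_fst)
      (snd (snd id))) (cons (pair (fst he).comp_fst (snd (snd id))) (const [])))) fun a => by
    obtain ⟨B, _ | ⟨x, t⟩⟩ := e a <;> rfl

end PolyTime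

/-- The measure `m` pays for the `2 ^ K a` subsets of each view. -/
theorem PolyTimeIn.subBags {α : Type} [TreeEncodable α] {m K : α → ℕ} (hm : ∀ a, encSize a ≤ m a)
    (hK : ∀ a, 2 ^ K a ≤ m a) {vs : α → List Bag} (hvs : PolyTime vs)
    (hl : ∀ a, ∀ v ∈ vs a, v.1.length ≤ K a) : PolyTimeIn m fun a => subBags (vs a) := by
  obtain ⟨P, hP⟩ := hvs.exists_encSize_le
  have hinit : PolyTime fun a => initialBags (vs a) :=
    .map (f := fun (_ : α) (v : Bag) => ((([], v.2), v.1) : PartialBag)) hvs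
      (.pair (.pair (.const []) (.snd (.snd .id))) (.fst (.snd .id)))
  have hstep : PolyTime fun x : α × List PartialBag × ℕ => x.2.1.flatMap branchOnNext :=
    .flatMap (.fst (.snd .id)) (.branchOnNext (.snd .id))
  have hfold (a : α) (l : List ℕ) :
      l.foldl (fun L _ => L.flatMap branchOnNext) (initialBags (vs a)) =
        partialBags (vs a) l.length :=
    List.foldl_const (fun L : List PartialBag => L.flatMap branchOnNext) _ _
  have hpartial : PolyTimeIn m fun a => partialBags (vs a) (covered (vs a)).length := by
    simp only [← hfold]
    refine PolyTimeIn.foldl hm (step := fun _ L _ => L.flatMap branchOnNext)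
      (hvs.covered.polyTimeIn hm) (hinit.polyTimeIn hm) hstep (P * .X * (P + 3) + 1)
      fun a l₁ _ => ?_
    rw [hfold]
    refine (encSize_partialBags_le (hl a) _).trans ?_
    have hvs_le := (hP a).trans (monotone_eval P (hm a))
    have hK_le := hK a
    simp only [eval_add, eval_mul, eval_X, eval_ofNat, eval_one]
    gcongr
  have hfst : PolyTime fun L : List PartialBag => L.map fun e => e.1 := .map .id (.fst (.snd .id))
  exact hfst.comp hpartial

theorem isComplete_of_isTree {ι : Type*} [Finite ι] {T : SimpleGraph ι} (hT : T.IsTree)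
    {χ : ι → Set ℕ} (hconv : PathConvex T χ) {E : List (List ℕ)} {vs : List Bag}
    (hE : ∀ e ∈ E, ∃ i, ∀ x ∈ e, x ∈ χ i) (hvs : ∀ i, ∃ v ∈ vs, ∀ x ∈ χ i, x ∈ v.1) :
    isComplete E (subBags vs) (decomposition E (subBags vs)) = true := by
  have : Nonempty ι := hT.connected.nonempty
  obtain ⟨n, hn⟩ := Nat.exists_eq_succ_of_ne_zero (Nat.card_pos (α := ι)).ne'
  obtain ⟨D, hbag, hempty, hχ⟩ := exists_bagSequence n hn hT hconv
  have hview : ∀ k, ∃ v ∈ vs, ∀ x ∈ D.bag k, x ∈ v.1 := fun k => by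
    rcases le_or_gt k n with hk | hk
    · obtain ⟨i, hi⟩ := hbag k hk
      exact hi ▸ hvs i
    · obtain ⟨v, hv, -⟩ := hvs (Classical.arbitrary ι)
      exact ⟨v, hv, by simp [hempty k hk]⟩
  refine BagSequence.Decomposes.isComplete_decomposition (D := D) ⟨fun e he => ?_, fun k S hS => ?_⟩
  · obtain ⟨i, hi⟩ := hE e he
    obtain ⟨k, -, hk⟩ := hχ i
    exact ⟨k, hk ▸ hi⟩
  · obtain ⟨v, hv, hsub⟩ := hview k
    obtain ⟨B, hB, -, hBS⟩ := exists_mem_subBags hv fun x hx => hsub x (hS hx)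
    exact ⟨B, hB, hBS⟩

theorem exists_bag_of_isComplete {E : List (List ℕ)} {BB : List Bag}
    (h : isComplete E BB (decomposition E BB) = true) {e : List ℕ} (he : e ∈ E) :
    ∃ B ∈ decomposition E BB, ∀ x ∈ e, x ∈ B.1 :=
  ((isPartial_decomposition E BB).edge e he).resolve_left fun ⟨x, hx, hncov⟩ =>
    hncov ((isComplete_iff.1 h).2 x (mem_verts.2 ⟨e, he, hx⟩))

/-! ### Queries -/

/-- The variables of a term. -/
def Term.varList : Term → List ℕ
  | .var x => [x]
  | .const _ => []

/-- The variables of an atom. -/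
def Atom.varList (a : Atom) : List ℕ := a.terms.flatMap Term.varList

/-- The hyperedges of a collection of atoms. -/
def edgesOf (A : List Atom) : List (List ℕ) := A.map Atom.varList

theorem Term.mem_varList {t : Term} {X : ℕ} : X ∈ t.varList ↔ t = .var X := by
  cases t <;> simp [varList, eq_comm]

theorem Atom.mem_varList {a : Atom} {X : ℕ} : X ∈ a.varList ↔ X ∈ a.vars := by
  simp [varList, vars, Term.mem_varList]

theorem Atom.setOf_varList (a : Atom) : {X | X ∈ a.varList} = a.vars :=
  Set.ext fun _ => Atom.mem_varList

theorem Atom.length_varList_le (a : Atom) : a.varList.length ≤ a.arity := by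
  have hterm (t : Term) : t.varList.length ≤ 1 := by cases t <;> simp [Term.varList]
  rw [varList, arity, List.length_flatMap]
  simpa using List.sum_le_card_nsmul (a.terms.map fun t => t.varList.length) 1
    (List.forall_mem_map.2 fun t _ => hterm t)

theorem arity_le_maxArity {A : List Atom} {a : Atom} (ha : a ∈ A) : a.arity ≤ maxArity A := by
  induction A with
  | nil => simp at ha
  | cons b A ih =>
    rcases List.mem_cons.1 ha with rfl | ha
    · exact le_max_left _ _
    · exact (ih ha).trans (le_max_right _ _)

theorem length_le_maxArity {A : List Atom} {e : List ℕ} (h : e ∈ edgesOf A) :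
    e.length ≤ maxArity A := by
  obtain ⟨a, ha, rfl⟩ := List.mem_map.1 h
  exact a.length_varList_le.trans (arity_le_maxArity ha)

theorem mem_edgeSet_hypergraphOf {A : List Atom} {h : Set ℕ} :
    h ∈ (hypergraphOf A).edgeSet ↔ ∃ e ∈ edgesOf A, h = {X | X ∈ e} := by
  simp [hypergraphOf, edgesOf, Atom.setOf_varList]

theorem mem_vertexSet_hypergraphOf {A : List Atom} {X : ℕ} :
    X ∈ (hypergraphOf A).vertexSet ↔ X ∈ verts (edgesOf A) := by
  simp [hypergraphOf, edgesOf, mem_verts, Atom.mem_varList]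

namespace PolyTime

theorem term_varList : PolyTime Term.varList := by
  let tag : Term → Bool × ℕ
    | .var X => (false, X)
    | .const c => (true, c)
  have htag : PolyTime tag := of_enc_eq fun t => by cases t <;> rfl
  exact congr (ite (fst htag) (const []) (cons (snd htag) (const []))) fun t => by cases t <;> rfl

theorem atom_varList : PolyTime Atom.varList := by
  have hpair : PolyTime fun a : Atom => (a.rel, a.terms) := of_enc_eq fun _ => rfl
  exact flatMap (snd hpair) (term_varList.comp (snd id))

theorem edgesOf {α : Type} [TreeEncodable α] {A : α → List Atom} (hA : PolyTime A) :
    PolyTime fun a => edgesOf (A a) :=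
  map hA (atom_varList.comp (snd id))

end PolyTime

/-! ### Fixed-parameter tractability -/

theorem computable_mul_two_pow_pow (k c d : ℕ) :
    Computable fun n => c * (2 ^ (k * n)) ^ d := by
  have hpow : Primrec₂ fun m n : ℕ => m ^ n := Primrec₂.unpaired'.1 Nat.Primrec.pow
  exact (Primrec.nat_mul.comp (.const c) (hpow.comp (hpow.comp (.const 2)
    (Primrec.nat_mul.comp (.const k) .id)) (.const d))).to_comp

theorem fixedParameterTractable_of_polyTimeIn {P : ParamProblem} [TreeEncodable P.Instance]
    (henc : ∀ x, P.encInstance x = enc x) {β : Type} [TreeEncodable β] {g : P.Instance → β} (k : ℕ)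
    (hg : PolyTimeIn (fun x => 2 ^ (k * P.param x) * encSize x) g)
    (hcorrect : ∀ x, P.CorrectAnswer x (enc (g x))) : P.FixedParameterTractable := by
  obtain ⟨Q, -, hprog⟩ := hg
  obtain ⟨p, hp⟩ := hprog 0
  refine ⟨p, _, Q.natDegree, computable_mul_two_pow_pow k (Q.eval 1) Q.natDegree,
    fun x => ⟨_, hcorrect x, ?_⟩⟩
  obtain ⟨s, t, hrun, hval, -, ht⟩ :=
    hp x (inputStore (P.encInstance x)) (by simp [inputStore, henc])
  refine ⟨s, t, hrun, hval, ht.trans ?_⟩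
  have hpos : 1 ≤ 2 ^ (k * P.param x) * encSize x := Nat.mul_pos (by positivity) (encSize_pos x)
  rw [henc, size_enc, mul_assoc, ← mul_pow]
  exact eval_le_eval_one_mul_pow Q hpos

/-! ### Tree projections -/

/-- The views of a collection of atoms; they need no label. -/
def viewsOf (A : List Atom) : List Bag := (edgesOf A).map fun e => (e, [])

/-- The hypergraph of the bags of the greedy decomposition. -/
def decompositionHypergraph (E : List (List ℕ)) (BB : List Bag) : Hypergraph ℕ where
  vertexSet := {x | x ∈ verts E}
  edgeSet := {h | ∃ B ∈ decomposition E BB, h = {x | x ∈ B.1}}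
  subset_vertexSet_of_mem_edgeSet' := by
    rintro _ ⟨B, hB, rfl⟩ x hx
    exact (isPartial_decomposition E BB).mem_verts B hB x hx

theorem isTreeProjection_decompositionHypergraph {A V : List Atom}
    (hcomplete : isComplete (edgesOf A) (subBags (viewsOf V))
      (decomposition (edgesOf A) (subBags (viewsOf V))) = true) :
    IsTreeProjection (hypergraphOf A) (hypergraphOf V)
      (decompositionHypergraph (edgesOf A) (subBags (viewsOf V))) := by
  have hpartial := isPartial_decomposition (edgesOf A) (subBags (viewsOf V))
  have hview : ∀ B ∈ subBags (viewsOf V), ∃ h ∈ (hypergraphOf V).edgeSet, {x | x ∈ B.1} ⊆ h := by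
    intro B hB
    obtain ⟨v, hv, -, hsub⟩ := exists_view_of_mem_subBags hB
    obtain ⟨e, he, rfl⟩ := List.mem_map.1 hv
    exact ⟨_, mem_edgeSet_hypergraphOf.2 ⟨e, he, rfl⟩, hsub⟩
  refine ⟨(verts (edgesOf A)).finite_toSet,
    hpartial.runningIntersection.isAcyclicHypergraph rfl, fun h hh => ?_, ?_⟩
  · obtain ⟨e, he, rfl⟩ := mem_edgeSet_hypergraphOf.1 hh
    obtain ⟨B, hB, hsub⟩ := exists_bag_of_isComplete hcomplete he
    exact ⟨_, ⟨B, hB, rfl⟩, hsub⟩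
  · rintro _ ⟨B, hB, rfl⟩
    rcases hpartial.mem B hB with rfl | hB
    · obtain ⟨B', hB'⟩ := List.exists_mem_of_ne_nil _ (isComplete_iff.1 hcomplete).1
      obtain ⟨h, hh, -⟩ := hview B' hB'
      exact ⟨h, hh, by simp⟩
    · exact hview B hB

theorem IsTreeProjection.isComplete {A V : List Atom} {H : Hypergraph ℕ}
    (hH : IsTreeProjection (hypergraphOf A) (hypergraphOf V) H) :
    isComplete (edgesOf A) (subBags (viewsOf V))
      (decomposition (edgesOf A) (subBags (viewsOf V))) = true := by
  obtain ⟨hfin, ⟨T, hT, hpath⟩, hA, hV⟩ := hH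
  have : Finite H.edgeSet :=
    hfin.finite_subsets.subset fun h hh => H.subset_vertexSet_of_mem_edgeSet' hh
  refine isComplete_of_isTree hT (χ := fun h => h.1) hpath (fun e he => ?_) fun h => ?_
  · obtain ⟨h, hh, hsub⟩ := hA _ (mem_edgeSet_hypergraphOf.2 ⟨e, he, rfl⟩)
    exact ⟨⟨h, hh⟩, hsub⟩
  · obtain ⟨h', hh', hsub⟩ := hV h.1 h.2
    obtain ⟨e, he, rfl⟩ := mem_edgeSet_hypergraphOf.1 hh'
    exact ⟨(e, []), List.mem_map_of_mem he, hsub⟩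

/-- The vertices and the bags of a tree projection, if there is one. -/
def treeProjectionOf (E : List (List ℕ)) (BB : List Bag) : Option (List ℕ × List (List ℕ)) :=
  if isComplete E BB (decomposition E BB) then
    some (verts E, (decomposition E BB).map fun B => B.1)
  else none

theorem PolyTime.treeProjectionOf :
    PolyTime fun x : List (List ℕ) × List Bag => treeProjectionOf x.1 x.2 :=
  have hdecomposition := decomposition (fst (id (α := List (List ℕ) × List Bag))) (snd id)
  ite (isComplete (fst id) (snd id) hdecomposition)
    (some (pair (verts (fst id)) (map hdecomposition (fst (snd id))))) (const none)

theorem correctAnswer_treeProjectionOf (x : ConjQuery × List Atom) :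
    treeProjectionProblem.CorrectAnswer x
      (enc (treeProjectionOf (edgesOf x.1.atoms) (subBags (viewsOf x.2)))) := by
  by_cases hcomplete : isComplete (edgesOf x.1.atoms) (subBags (viewsOf x.2))
      (decomposition (edgesOf x.1.atoms) (subBags (viewsOf x.2))) = true
  · rw [treeProjectionOf, if_pos hcomplete]
    refine .inl ⟨_, _, rfl, ⟨_, _, rfl, ?_, rfl⟩,
      isTreeProjection_decompositionHypergraph hcomplete⟩
    simp [decompositionHypergraph]
  · rw [treeProjectionOf, if_neg hcomplete]
    exact .inr ⟨rfl, fun ⟨_, hH⟩ => hcomplete hH.isComplete⟩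

instance : TreeEncodable treeProjectionProblem.Instance :=
  inferInstanceAs (TreeEncodable (ConjQuery × List Atom))

theorem PolyTime.conjQuery_atoms : PolyTime ConjQuery.atoms := of_enc_eq fun _ => rfl

theorem fixedParameterTractable_treeProjectionProblem :
    treeProjectionProblem.FixedParameterTractable := by
  refine fixedParameterTractable_of_polyTimeIn (fun _ => rfl) 1 ?_ correctAnswer_treeProjectionOf
  have hsize (x : treeProjectionProblem.Instance) :
      encSize x ≤ 2 ^ (1 * treeProjectionProblem.param x) * encSize x :=
    Nat.le_mul_of_pos_left _ (by positivity)
  have hedges : PolyTime fun x : treeProjectionProblem.Instance => edgesOf x.1.atoms :=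
    .edgesOf (PolyTime.conjQuery_atoms.comp
      (PolyTime.fst (PolyTime.id (α := ConjQuery × List Atom))))
  have hviews : PolyTime fun x : treeProjectionProblem.Instance => viewsOf x.2 :=
    .map (.edgesOf (.snd (.id (α := ConjQuery × List Atom)))) (.pair (.snd .id) (.const []))
  refine PolyTime.treeProjectionOf.comp (PolyTimeIn.pair hsize (hedges.polyTimeIn hsize)
    (PolyTimeIn.subBags hsize (K := fun x => treeProjectionProblem.param x)
      (fun x => ?_) hviews fun x v hv => ?_))
  · rw [one_mul]
    exact Nat.le_mul_of_pos_right _ (encSize_pos x)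
  · obtain ⟨e, he, rfl⟩ := List.mem_map.1 hv
    refine length_le_maxArity (A := x.1.atoms ++ x.2) ?_
    rw [edgesOf, List.map_append]
    exact List.mem_append_right _ he

/-! ### Generalized hypertree decompositions -/

/-- The unions of at most `w` hyperedges, labelled with these hyperedges. -/
def unionsOf (E : List (List ℕ)) : ℕ → List Bag
  | 0 => [([], [])]
  | w + 1 => unionsOf E w ++ (unionsOf E w).flatMap fun v => E.map fun e => (e ++ v.1, e :: v.2)

theorem mem_unionsOf {E : List (List ℕ)} {w : ℕ} {v : Bag} :
    v ∈ unionsOf E w ↔ v.1 = v.2.flatten ∧ (∀ e ∈ v.2, e ∈ E) ∧ v.2.length ≤ w := by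
  obtain ⟨l, label⟩ := v
  induction w generalizing l label with
  | zero =>
    simp only [unionsOf, List.mem_singleton, Prod.mk.injEq, Nat.le_zero, List.length_eq_zero_iff]
    constructor
    · rintro ⟨rfl, rfl⟩
      simp
    · rintro ⟨rfl, -, rfl⟩
      simp
  | succ w ih =>
    simp only [unionsOf, List.mem_append, List.mem_flatMap, List.mem_map, Prod.mk.injEq,
      Prod.exists, ih]
    constructor
    · rintro (⟨hl, hE, hw⟩ | ⟨_, label, ⟨rfl, hE, hw⟩, e, he, rfl, rfl⟩)
      · exact ⟨hl, hE, hw.trans (Nat.le_succ w)⟩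
      · exact ⟨rfl, List.forall_mem_cons.2 ⟨he, hE⟩, Nat.succ_le_succ hw⟩
    · rintro ⟨rfl, hE, hw⟩
      cases label with
      | nil => exact .inl ⟨rfl, hE, Nat.zero_le w⟩
      | cons e label =>
        obtain ⟨he, hE⟩ := List.forall_mem_cons.1 hE
        exact .inr ⟨_, label, ⟨rfl, hE, Nat.le_of_succ_le_succ hw⟩, e, he, rfl, rfl⟩

theorem length_le_of_mem_unionsOf {E : List (List ℕ)} {w K : ℕ} (hE : ∀ e ∈ E, e.length ≤ K)
    {v : Bag} (hv : v ∈ unionsOf E w) : v.1.length ≤ w * K := by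
  obtain ⟨heq, hmem, hw⟩ := mem_unionsOf.1 hv
  rw [heq, List.length_flatten]
  have hsum := List.sum_le_card_nsmul (v.2.map List.length) K
    (List.forall_mem_map.2 fun e he => hE e (hmem e he))
  rw [List.length_map, smul_eq_mul] at hsum
  exact hsum.trans (Nat.mul_le_mul_right K hw)

theorem exists_mem_unionsOf {A : List Atom} {S : Set (Set ℕ)} {w : ℕ}
    (hS : S ⊆ (hypergraphOf A).edgeSet) (hw : S.encard ≤ w) :
    ∃ v ∈ unionsOf (edgesOf A) w, ∀ x ∈ ⋃₀ S, x ∈ v.1 := by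
  have hfin : S.Finite := Set.finite_of_encard_le_coe hw
  choose! list hlist using fun h (hh : h ∈ S) => mem_edgeSet_hypergraphOf.1 (hS hh)
  have hmem {h : Set ℕ} : h ∈ hfin.toFinset.toList ↔ h ∈ S := by simp
  refine ⟨((hfin.toFinset.toList.map list).flatten, hfin.toFinset.toList.map list),
    mem_unionsOf.2 ⟨rfl, ?_, ?_⟩, ?_⟩
  · exact List.forall_mem_map.2 fun h hh => (hlist h (hmem.1 hh)).1
  · rw [List.length_map, Finset.length_toList]
    rw [hfin.encard_eq_coe_toFinset_card] at hw
    exact_mod_cast hw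
  · rintro x ⟨h, hh, hx⟩
    rw [(hlist h hh).2] at hx
    exact List.mem_flatten.2 ⟨list h, List.mem_map_of_mem (hmem.2 hh), hx⟩

theorem encard_setOf_le (l : List (List ℕ)) :
    {h : Set ℕ | ∃ e ∈ l, h = {x | x ∈ e}}.encard ≤ l.length := by
  classical
  have himage : {h : Set ℕ | ∃ e ∈ l, h = {x | x ∈ e}} =
      (fun e : List ℕ => {x | x ∈ e}) '' (l.toFinset : Set (List ℕ)) := by
    ext h
    simp [eq_comm]
  rw [himage]
  refine (Set.encard_image_le _ _).trans ?_
  rw [Set.encard_coe_eq_coe_finsetCard]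
  exact_mod_cast l.toFinset_card_le

section

variable {L : List Bag} {par : ℕ → ℕ}

/-- The bag number `i`, counted from the end of `L`, with its label. -/
def labelledBagAt (L : List Bag) (i : Fin L.length) : Bag :=
  L.reverse.get (i.cast L.length_reverse.symm)

theorem labelledBagAt_mem (i : Fin L.length) : labelledBagAt L i ∈ L :=
  List.mem_reverse.1 (List.get_mem _ _)

theorem bagAt_eq (i : Fin L.length) : bagAt L i.1 = (labelledBagAt L i).1 := by
  rw [bagAt, List.getD_eq_getElem _ _ (by simp)]
  rfl

/-- The hypertree whose vertices are the numbers of the bags of `L`, with their parents given by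
`par`; a bag is labelled with the hyperedges that cover it. -/
def IsNumbering.hypertree (h : IsNumbering L par) : Hypertree where
  N := L.length
  T := parentGraph L.length par
  root := ⟨0, h.pos⟩
  χ i := {x | x ∈ (labelledBagAt L i).1}
  lam i := {s | ∃ e ∈ (labelledBagAt L i).2, s = {x | x ∈ e}}

theorem IsNumbering.preconnected_hypertree (h : IsNumbering L par) (x : ℕ) :
    (h.hypertree.T.induce {p | x ∈ h.hypertree.χ p}).Preconnected := by
  have hχ : {p | x ∈ h.hypertree.χ p} = {p : Fin L.length | x ∈ bagAt L p.1} := by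
    ext p
    simp [bagAt_eq, hypertree]
  rw [hχ]
  exact h.preconnected x

theorem IsNumbering.par_lt_length (h : IsNumbering L par) (i : Fin L.length) :
    par i.1 < L.length := by
  rcases Nat.eq_zero_or_pos i.1 with hi | hi
  · rw [hi, h.par_zero]
    exact h.pos
  · exact (h.par_lt i.1 hi i.2).trans i.2

theorem encList_map {α β : Type} (f : β → BTree) (g : α → β) (l : List α) :
    encList f (l.map g) = encList (fun a => f (g a)) l := by
  induction l with
  | nil => rfl
  | cons a l ih => simp [encList, ih]

theorem IsNumbering.encodesHypertree (h : IsNumbering L par) :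
    EncodesHypertree (enc ((0 : ℕ), L.reverse, (number L).map fun e => (e.1, e.2.1)))
      h.hypertree := by
  let arcs : List (Fin L.length × Fin L.length) :=
    ((List.finRange L.length).map fun i => (i, ⟨par i.1, h.par_lt_length i⟩)).reverse
  have hmem_arcs (p q : Fin L.length) : (p, q) ∈ arcs ↔ q.1 = par p.1 := by
    simp only [arcs, List.mem_reverse, List.mem_map, List.mem_finRange, true_and, Prod.mk.injEq,
      Fin.ext_iff]
    exact ⟨fun ⟨i, hp, hq⟩ => hp ▸ hq.symm, fun hq => ⟨p, rfl, hq.symm⟩⟩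
  have hlabels : List.ofFn (labelledBagAt L) = L.reverse :=
    List.ext_getElem (by simp) fun i _ _ => by simp [labelledBagAt]
  have harcs : (number L).map (fun e => (e.1, e.2.1)) = arcs.map fun a => (a.1.1, a.2.1) := by
    simp only [h.number_eq, arcs, ← List.map_coe_finRange_eq_range, List.map_reverse, List.map_map,
      Function.comp_def]
  refine ⟨labelledBagAt L, arcs, fun _ => rfl, fun _ => rfl, ?_, ?_⟩
  · exact congrArg SimpleGraph.fromRel (funext₂ fun p q => propext (hmem_arcs p q).symm)
  · rw [harcs, ← hlabels]
    exact congrArg (fun t => BTree.pair _ (.pair _ t)) (encList_map enc _ arcs)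

end

theorem isGHD_hypertree_of_isComplete {A : List Atom} {w : ℕ}
    (hcomplete : isComplete (edgesOf A) (subBags (unionsOf (edgesOf A) w))
      (decomposition (edgesOf A) (subBags (unionsOf (edgesOf A) w))) = true)
    {par : ℕ → ℕ}
    (h : IsNumbering (decomposition (edgesOf A) (subBags (unionsOf (edgesOf A) w))) par) :
    IsGHD (hypergraphOf A) h.hypertree ∧ h.hypertree.WidthAtMost w := by
  have hpartial := isPartial_decomposition (edgesOf A) (subBags (unionsOf (edgesOf A) w))
  set L := decomposition (edgesOf A) (subBags (unionsOf (edgesOf A) w))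
  have hlabel : ∀ B ∈ L, (∀ x ∈ B.1, x ∈ B.2.flatten) ∧ (∀ e ∈ B.2, e ∈ edgesOf A) ∧
      B.2.length ≤ w := by
    intro B hB
    rcases hpartial.mem B hB with rfl | hB
    · simp
    · obtain ⟨v, hv, hlabel, hsub⟩ := exists_view_of_mem_subBags hB
      obtain ⟨hunion, hedges, hw⟩ := mem_unionsOf.1 hv
      rw [hlabel, ← hunion]
      exact ⟨hsub, hedges, hw⟩
  have hlabelAt (p : Fin L.length) := hlabel _ (labelledBagAt_mem p)
  refine ⟨⟨h.isTree, fun p x hx => ?_, ?_, fun s hs => ?_, fun x _ => h.preconnected_hypertree x,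
    fun p x hx => ?_⟩, fun p => ?_⟩
  · exact mem_vertexSet_hypergraphOf.2 (hpartial.mem_verts _ (labelledBagAt_mem p) x hx)
  · rintro p _ ⟨e, he, rfl⟩
    exact mem_edgeSet_hypergraphOf.2 ⟨e, (hlabelAt p).2.1 e he, rfl⟩
  · obtain ⟨e, he, rfl⟩ := mem_edgeSet_hypergraphOf.1 hs
    obtain ⟨B, hB, hsub⟩ := exists_bag_of_isComplete hcomplete he
    obtain ⟨i, hi, heq⟩ := exists_bagAt_eq_of_mem hB
    rw [bagAt_eq ⟨i, hi⟩] at heq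
    exact ⟨⟨i, hi⟩, fun x hx => (heq ▸ hsub x hx : x ∈ (labelledBagAt L ⟨i, hi⟩).1)⟩
  · obtain ⟨e, he, hxe⟩ := List.mem_flatten.1 ((hlabelAt p).1 x hx)
    exact ⟨_, ⟨e, he, rfl⟩, hxe⟩
  · exact (encard_setOf_le _).trans (by exact_mod_cast (hlabelAt p).2.2)

theorem IsGHD.isComplete {A : List Atom} {w : ℕ} {D : Hypertree} (hD : IsGHD (hypergraphOf A) D)
    (hw : D.WidthAtMost w) :
    isComplete (edgesOf A) (subBags (unionsOf (edgesOf A) w))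
      (decomposition (edgesOf A) (subBags (unionsOf (edgesOf A) w))) = true := by
  have hconv : PathConvex D.T D.χ := pathConvex_of_preconnected hD.isTree.isAcyclic fun x => by
    by_cases hx : x ∈ (hypergraphOf A).vertexSet
    · exact hD.connected x hx
    · exact fun ⟨p, hp⟩ => absurd (hD.χ_subset p hp) hx
  refine isComplete_of_isTree hD.isTree hconv (fun e he => ?_) fun p => ?_
  · exact hD.edge_covered _ (mem_edgeSet_hypergraphOf.2 ⟨e, he, rfl⟩)
  · obtain ⟨v, hv, hsub⟩ := exists_mem_unionsOf (hD.lam_subset p) (hw p)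
    exact ⟨v, hv, fun x hx => hsub x (hD.χ_subset_lam p hx)⟩

/-- The root, the labels and the arcs of a generalized hypertree decomposition, if there is one. -/
def hypertreeOf (E : List (List ℕ)) (BB : List Bag) : Option (ℕ × List Bag × List (ℕ × ℕ)) :=
  if isComplete E BB (decomposition E BB) then
    some (0, (decomposition E BB).reverse,
      (number (decomposition E BB)).map fun e => (e.1, e.2.1))
  else none

theorem correctAnswer_hypertreeOf (w : ℕ) (Q : ConjQuery) : (ghdProblem w).CorrectAnswer Q
    (enc (hypertreeOf (edgesOf Q.atoms) (subBags (unionsOf (edgesOf Q.atoms) w)))) := by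
  by_cases hcomplete : isComplete (edgesOf Q.atoms) (subBags (unionsOf (edgesOf Q.atoms) w))
      (decomposition (edgesOf Q.atoms) (subBags (unionsOf (edgesOf Q.atoms) w))) = true
  · rw [hypertreeOf, if_pos hcomplete]
    obtain ⟨par, hpar⟩ := (isPartial_decomposition (edgesOf Q.atoms)
      (subBags (unionsOf (edgesOf Q.atoms) w))).runningIntersection.exists_isNumbering
    exact .inl ⟨hpar.hypertree, _, rfl, hpar.encodesHypertree,
      isGHD_hypertree_of_isComplete hcomplete hpar⟩
  · rw [hypertreeOf, if_neg hcomplete]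
    exact .inr ⟨rfl, fun ⟨_, hD, hw⟩ => hcomplete (hD.isComplete hw)⟩

namespace PolyTime

theorem unionsOf {α : Type} [TreeEncodable α] {E : α → List (List ℕ)} (hE : PolyTime E) (w : ℕ) :
    PolyTime fun a => unionsOf (E a) w := by
  induction w with
  | zero => exact const _
  | succ w ih =>
    exact append ih (flatMap ih (map hE.comp_fst (pair (append (snd id) (fst (snd (fst id))))
      (cons (snd id) (snd (snd (fst id)))))))

theorem hypertreeOf : PolyTime fun x : List (List ℕ) × List Bag => hypertreeOf x.1 x.2 :=
  have hdecomposition := decomposition (fst (id (α := List (List ℕ) × List Bag))) (snd id)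
  ite (isComplete (fst id) (snd id) hdecomposition)
    (some (pair (const 0) (pair hdecomposition.reverse (map hdecomposition.number
      (pair (fst (snd id)) (fst (snd (snd id)))))))) (const none)

end PolyTime

instance (w : ℕ) : TreeEncodable (ghdProblem w).Instance :=
  inferInstanceAs (TreeEncodable ConjQuery)

theorem fixedParameterTractable_ghdProblem (w : ℕ) : (ghdProblem w).FixedParameterTractable := by
  refine fixedParameterTractable_of_polyTimeIn (fun _ => rfl) w ?_ (correctAnswer_hypertreeOf w)
  have hsize (x : (ghdProblem w).Instance) :
      encSize x ≤ 2 ^ (w * (ghdProblem w).param x) * encSize x :=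
    Nat.le_mul_of_pos_left _ (by positivity)
  have hedges : PolyTime fun x : (ghdProblem w).Instance => edgesOf x.atoms :=
    PolyTime.edgesOf PolyTime.conjQuery_atoms
  refine PolyTime.hypertreeOf.comp (PolyTimeIn.pair hsize (hedges.polyTimeIn hsize)
    (PolyTimeIn.subBags hsize (K := fun x => w * (ghdProblem w).param x)
      (fun x => Nat.le_mul_of_pos_right _ (encSize_pos x)) (hedges.unionsOf w) fun x v hv => ?_))
  exact length_le_of_mem_unionsOf (fun e he => length_le_maxArity he) hv

end TreeProj

theorem mainTheorem12 :
    TreeProj.treeProjectionProblem.FixedParameterTractable ∧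
      ∀ w : ℕ, 1 ≤ w → (TreeProj.ghdProblem w).FixedParameterTractable :=
  ⟨TreeProj.fixedParameterTractable_treeProjectionProblem,
    fun w _ => TreeProj.fixedParameterTractable_ghdProblem w⟩
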